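/- **Setting.** Let $d\ge 1$ and let $D\subset\mathbb R^d$ be a bounded polyhedral domain (bounded, nonempty, open, connected, $D=\operatorname{int}\overline D$, with $\partial D$ contained in a finite union of hyperplanes), with surface measure $ds$ and outward unit normal $\mathbf n$. Let $(\varphi_i)_{i\in\mathcal V}$, $\mathcal V$ finite, be the global shape functions of a continuous finite element space: each $\varphi_i$ is Lipschitz on $\overline D$, nonnegative, not identically zero on $D$, and $\sum_{i}\varphi_i=1$ on $\overline D$. Put $$m_i=\int_D\varphi_i,\quad m_{ij}=\int_D\varphi_i\varphi_j,\quad \mathbf c_{ij}=\int_D\varphi_i\nabla\varphi_j,\quad \mathbf n_{ij}=\frac{\mathbf c_{ij}}{\|\mathbf c_{ij}\|},\quad b_{ij}=\delta_{ij}-\frac{m_{ij}}{m_j},$$ $\mathcal I(i)=\{j:\ |\operatorname{supp}\varphi_j\cap\operatorname{supp}\varphi_i|\ne0\}$, $\mathcal I^*(i)=\mathcal I(i)\setminus\{i\}$, $\lambda_i=(\operatorname{card}\mathcal I(i)-1)^{-1}$. Let $\mathcal V^\partial$ be the set of those $i$ with $\varphi_i\not\equiv0$ on $\partial D$, and put $m_i^\partial=\big\|\int_{\partial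 D}\varphi_i\mathbf n\,ds\big\|$, $\mathbf n_i=\frac1{m_i^\partial}\int_{\partial D}\varphi_i\mathbf n\,ds$ (only the product $m_i^\partial\mathbf n_i$ matters if $m_i^\partial=0$). A state $u=(\rho,\mathbf m,E)\in\mathbb R\times\mathbb R^d\times\mathbb R$ has velocity $\mathbf v=\mathbf m/\rho$, specific internal energy $e=E/\rho-\frac12\|\mathbf m/\rho\|^2$ and internal energy $\varepsilon=E-\|\mathbf m\|^2/(2\rho)$; it is *admissible* if $\rho>0$ and $e>0$. The pressure $p(u)$ is any function that is positive on admissible states (for instance the ideal gas law $p=(\gamma-1)\rho e$, $\gamma>1$), and $f(u)=(\mathbf m,\ \mathbf v\otimes\mathbf m+p\,\mathbb I,\ \mathbf v(E+p))^{\mathsf T}$. *Wave speeds.* For an admissible state $Z$ let $\gamma_Z=1+\frac{p_Z}{\rho_Ze_Z}$ (equal to $\gamma$ for an ideal gas), $a_Z=\sqrt{\gamma_Zp_Z/\rho_Z}$, and $$f_Z(q)=\begin{cases}(q-p_Z)\sqrt{\dfrac{2/((\gamma_Z+1)\rho_Z)}{q+\frac{\gamma_Z-1}{\gamma_Z+1}p_Z}},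 & q\ge p_Z,\\[2mm] \dfrac{2a_Z}{\gamma_Z-1}\Big(\big(\tfrac q{p_Z}\big)^{\frac{\gamma_Z-1}{2\gamma_Z}}-1\Big), & 0\le q<p_Z.\end{cases}$$ For the Riemann problem with left state $L$, right state $R$ and flux $f(\cdot)\mathbf n$, $\|\mathbf n\|=1$, let $p^*\ge0$ be the smallest $q\ge 0$ with $f_L(q)+f_R(q)+(\mathbf v_R-\mathbf v_L)\cdot\mathbf n\ge0$. The maximum wave speed is $\max(|\lambda_1^-|,|\lambda_3^+|)$, where $$\lambda_1^-=\mathbf v_L\cdot\mathbf n-a_L\sqrt{1+\tfrac{\gamma_L+1}{2\gamma_L}\max\big(\tfrac{p^*-p_L}{p_L},0\big)},\qquad \lambda_3^+=\mathbf v_R\cdot\mathbf n+a_R\sqrt{1+\tfrac{\gamma_R+1}{2\gamma_R}\max\big(\tfrac{p^*-p_R}{p_R},0\big)} .$$ Let $\lambda^{\max}(L,R,\mathbf n)$ be any upper bound on it. *One forward-Euler step.* Let $\mathsf U^n=(\mathsf U_i^n)_{i\in\mathcal V}$ be states, $\alpha_i\in[0,1]$, $\gamma>1$ and $c_{\rm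 cfl}>0$. For $i\ne j$ let $d^L_{ij}=\max\big(\lambda^{\max}(\mathsf U_i^n,\mathsf U_j^n,\mathbf n_{ij})\|\mathbf c_{ij}\|,\ \lambda^{\max}(\mathsf U_j^n,\mathsf U_i^n,\mathbf n_{ji})\|\mathbf c_{ji}\|\big)$; let $d^L_{ii}=-\sum_{j\in\mathcal I^*(i)}d^L_{ij}$, $d^H_{ij}=\frac{\alpha_i+\alpha_j}2d^L_{ij}$ and $\tau_n=c_{\rm cfl}\min_i\big(-\frac{m_i}{2d^L_{ii}}\big)$ (indices with $d_{ii}^L=0$ impose no restriction and are left out; in the degenerate case where all $d^L_{ii}$ vanish, $\tau_n=0$). Put $$m_i(\mathsf U_i^{L}-\mathsf U_i^n)=\tau_n\sum_{j\in\mathcal I(i)}\big(-f(\mathsf U_j^n)\mathbf c_{ij}+d^L_{ij}(\mathsf U_j^n-\mathsf U_i^n)\big),\qquad F_i^H=\sum_{j\in\mathcal I(i)}\big(-f(\mathsf U_j^n)\mathbf c_{ij}+d^H_{ij}(\mathsf U_j^n-\mathsf U_i^n)\big),$$ $$P_{ij}=\frac{\tau_n}{m_i\lambda_i}\big(b_{ij}F_j^H-b_{ji}F_i^H+(d^H_{ij}-d^L_{ij})(\mathsf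 U_j^n-\mathsf U_i^n)\big),\qquad \overline{\mathsf U}_{ij}=\tfrac12(\mathsf U_i^n+\mathsf U_j^n)-\frac1{2d^L_{ij}}\big(f(\mathsf U_j^n)-f(\mathsf U_i^n)\big)\mathbf c_{ij},$$ where the last term is absent if $d^L_{ij}=0$. *Limiting.* A pass of limiting maps states and increments $(W_i,P_{ij})$ to $$\Big(W_i+\sum_{j\in\mathcal I^*(i)}\lambda_i\ell_{ij}P_{ij},\ (1-\ell_{ij})P_{ij}\Big),\qquad \ell_{ij}=\min(\ell^i_j,\ell^j_i),$$ where $\ell^i_j$ is the largest $\ell\in[0,1]$ (the supremum, with value $0$ if there is no such $\ell$) for which the state $W_i+\ell P_{ij}$ has $\rho\ge\min_{k\in\mathcal I(i)}\rho(\overline{\mathsf U}_{ik})$, $-\rho\ge\min_{k\in\mathcal I(i)}\big(-\rho(\overline{\mathsf U}_{ik})\big)$ and $\Phi\ge\min_{k\in\mathcal I(i)}\Phi(\mathsf U_k^n)$, with $\Phi(u)=\varepsilon(u)\rho^{-\gamma}$. The update $\mathsf U^{n+1}$ is obtained from $(\mathsf U_i^L,P_{ij})$ by $K\ge1$ passes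 of limiting, $K$ arbitrary. **Lemma.** (i) For all $u_h=\sum_{i\in\mathcal V}\mathsf U_i\varphi_i$ with $\mathsf U_i\in\mathbb R^{d+2}$, $u_h$ is integrable on $D$ and $\int_Du_h\,dx=\sum_{i\in\mathcal V}m_i\mathsf U_i$. (ii) Let $\mathsf U^n$ be a collection of admissible states and let $\mathsf U^{n+1}$ be the update after one forward-Euler step and after limiting. If $c_{\rm cfl}\le1$, then every $\mathsf U_i^{n+1}$ is admissible. Moreover $$\sum_{i\in\mathcal V}m_i\mathsf U_i^{n+1}+\tau_n\sum_{i\in\mathcal V^\partial}m_i^\partial f(\mathsf U_i^n)\mathbf n_i=\sum_{i\in\mathcal V}m_i\mathsf U_i^n .$$ -/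

import Mathlib

open MeasureTheory Set Finset
open scoped NNReal

noncomputable section

namespace EulerFE

/-! ### States, pressure, flux -/

/-- Vectors of the physical space `ℝ^d`, with the Euclidean norm. -/
abbrev Vec (d : ℕ) : Type := EuclideanSpace ℝ (Fin d)

/-- A state `u = (ρ, m, E)` in `ℝ^{d+2}`: density, momentum, total energy. -/
abbrev State (d : ℕ) : Type := ℝ × Vec d × ℝ

variable {d : ℕ}

/-- Density. -/
def rho (u : State d) : ℝ := u.1

/-- Momentum. -/
def mom (u : State d) : Vec d := u.2.1

/-- Total energy. -/
def energy (u : State d) : ℝ := u.2.2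

/-- Velocity `v = m / ρ`. -/
def vel (u : State d) : Vec d := (rho u)⁻¹ • mom u

/-- Specific internal energy `e(u) = E / ρ - ‖m / ρ‖² / 2`. -/
def specificInternalEnergy (u : State d) : ℝ :=
  (rho u)⁻¹ * energy u - (1 / 2) * ‖(rho u)⁻¹ • mom u‖ ^ 2

/-- Internal energy `ε(u) = E - ‖m‖² / (2 ρ)`. -/
def internalEnergy (u : State d) : ℝ := energy u - ‖mom u‖ ^ 2 / (2 * rho u)

/-- Admissible states: positive density and positive specific internal energy. -/
def IsAdmissible (u : State d) : Prop := 0 < rho u ∧ 0 < specificInternalEnergy u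

/-- The Euler flux `f(u) = (m, v ⊗ m + p(u) I, v (E + p(u)))ᵀ`, a `(d+2) × d` matrix, applied to
a vector `c` of `ℝ^d`; here `p` is the pressure and `(v ⊗ m) c = (m · c) v`. -/
def flux (p : State d → ℝ) (u : State d) (c : Vec d) : State d :=
  (inner ℝ (mom u) c,
   inner ℝ (mom u) c • vel u + p u • c,
   inner ℝ (vel u) c * (energy u + p u))

/-! ### Maximum wave speed in the Riemann problem

The Riemann problem has left state `uL`, right state `uR` and flux `f(w) n`, with `n` a unit
vector. Its solution consists of two extreme waves (shock or rarefaction) separated by a region of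
constant pressure and normal velocity, possibly containing a contact discontinuity or vacuum. -/

/-- The ratio `γ(u) = 1 + p(u) / (ρ e(u))`. It is the constant `γ` for the ideal gas law
`p = (γ - 1) ρ e`. -/
def gam (p : State d → ℝ) (u : State d) : ℝ :=
  1 + p u / (rho u * specificInternalEnergy u)

/-- The sound speed `a = √(γ p / ρ)`. -/
def soundSpeed (p : State d → ℝ) (u : State d) : ℝ := Real.sqrt (gam p u * p u / rho u)

/-- The change of normal velocity across the wave that connects the state `u` to a state of
pressure `q`: shock branch (Rankine-Hugoniot) if `p(u) ≤ q`, rarefaction branch (isentropic) if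
`q < p(u)`. -/
def waveCurve (p : State d → ℝ) (u : State d) (q : ℝ) : ℝ :=
  if p u ≤ q then
    (q - p u) *
      Real.sqrt ((2 / ((gam p u + 1) * rho u)) / (q + (gam p u - 1) / (gam p u + 1) * p u))
  else
    2 * soundSpeed p u / (gam p u - 1) * ((q / p u) ^ ((gam p u - 1) / (2 * gam p u)) - 1)

/-- The pressure `p*` of the intermediate region: the zero of the increasing function
`q ↦ f_L(q) + f_R(q) + (v_R - v_L) · n` on `[0, ∞)`, and `p* = 0` if this function is nonnegative
at `0` (formation of vacuum). -/
def starPressure (p : State d → ℝ) (uL uR : State d) (n : Vec d) : ℝ :=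
  sInf {q : ℝ | 0 ≤ q ∧
    0 ≤ waveCurve p uL q + waveCurve p uR q + inner ℝ (vel uR - vel uL) n}

/-- Speed relative to the gas, in absolute value, of the head of the wave that connects `u` to the
pressure `q`: the shock speed if `p(u) ≤ q`, the sound speed otherwise. -/
def headSpeed (p : State d → ℝ) (u : State d) (q : ℝ) : ℝ :=
  soundSpeed p u *
    Real.sqrt (1 + (gam p u + 1) / (2 * gam p u) * max ((q - p u) / p u) 0)

/-- The maximum wave speed `max(|λ₁⁻|, |λ₃⁺|)` in the Riemann problem. -/
def maxWaveSpeed (p : State d → ℝ) (uL uR : State d) (n : Vec d) : ℝ :=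
  max |inner ℝ (vel uL) n - headSpeed p uL (starPressure p uL uR n)|
      |inner ℝ (vel uR) n + headSpeed p uR (starPressure p uL uR n)|

/-- `lam uL uR n` is a guaranteed upper bound on the maximum wave speed in the Riemann problem, for
all admissible left and right states and all unit vectors `n`. -/
def IsWaveSpeedBound (p : State d → ℝ) (lam : State d → State d → Vec d → ℝ) : Prop :=
  ∀ uL uR : State d, IsAdmissible uL → IsAdmissible uR →
    ∀ n : Vec d, ‖n‖ = 1 → maxWaveSpeed p uL uR n ≤ lam uL uR n

/-! ### The computational domain -/

/-- Bounded polyhedral domain: a bounded, connected, nonempty open set that lies on one side of its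
boundary and whose boundary is contained in a finite union of hyperplanes. -/
structure IsPolyhedralDomain (D : Set (Vec d)) : Prop where
  isOpen : IsOpen D
  isBounded : Bornology.IsBounded D
  isConnected : IsConnected D
  interior_closure : interior (closure D) = D
  frontier_subset : ∃ H : Finset (Vec d × ℝ), (∀ h ∈ H, h.1 ≠ 0) ∧
    frontier D ⊆ ⋃ h ∈ H, {x : Vec d | inner ℝ h.1 x = h.2}

/-- `n` is the outward unit normal of `D` at the boundary point `x`, where the boundary is flat:
near `x`, the set `D` is the open half-space behind the hyperplane through `x` orthogonal to `n`. -/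
def IsOutwardNormal (D : Set (Vec d)) (x n : Vec d) : Prop :=
  ‖n‖ = 1 ∧ ∃ r > 0, ∀ y ∈ Metric.ball x r, (y ∈ D ↔ inner ℝ (y - x) n < 0)

open scoped Classical in
/-- The outward unit normal field on `∂D`; on a polyhedral boundary it is defined off the edges
and corners (a set of zero surface measure), where we set it to `0`. -/
def outwardNormal (D : Set (Vec d)) (x : Vec d) : Vec d :=
  if h : ∃ n : Vec d, IsOutwardNormal D x n then h.choose else 0

/-- The surface measure on `∂D`: the `(d-1)`-dimensional Hausdorff measure, normalized so as to
agree with the Lebesgue measure on hyperplanes. -/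
def surfaceMeasure (D : Set (Vec d)) : Measure (Vec d) :=
  (Measure.euclideanHausdorffMeasure (d - 1) : Measure (Vec d)).restrict (frontier D)

/-! ### Shape functions and mesh-dependent quantities -/

/-- Global shape functions of a continuous finite element space on `D` (continuous and piecewise
smooth, hence Lipschitz, on the closure of `D`; none of them vanishes identically): nonnegative,
with the partition of unity property. -/
structure IsShapeFamily {V : Type*} [Fintype V] (D : Set (Vec d)) (φ : V → Vec d → ℝ) :
    Prop where
  lipschitz : ∀ i, ∃ L : ℝ≥0, LipschitzOnWith L (φ i) (closure D)
  nonneg : ∀ i, ∀ x ∈ closure D, 0 ≤ φ i x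
  sum_eq_one : ∀ x ∈ closure D, ∑ i, φ i x = 1
  exists_ne_zero : ∀ i, ∃ x ∈ D, φ i x ≠ 0

section Mesh

variable {V : Type*} (D : Set (Vec d)) (φ : V → Vec d → ℝ)

/-- Support in the closure of `D`. -/
def supp (i : V) : Set (Vec d) := closure {x ∈ D | φ i x ≠ 0}

open scoped Classical in
/-- The stencil `I(i)`: indices `j` with `|supp φ_j ∩ supp φ_i| ≠ 0`. -/
def stencil [Fintype V] (i : V) : Finset V :=
  Finset.univ.filter fun j => volume (supp D φ j ∩ supp D φ i) ≠ 0

open scoped Classical in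
/-- `I*(i) = I(i) \ {i}`. -/
def stencilStar [Fintype V] (i : V) : Finset V := (stencil D φ i).erase i

open scoped Classical in
/-- The boundary degrees of freedom: the shape function does not vanish identically on `∂D`. -/
def boundaryNodes [Fintype V] : Finset V :=
  Finset.univ.filter fun i => ∃ x ∈ frontier D, φ i x ≠ 0

/-- Lumped mass `m_i = ∫_D φ_i`. -/
def mass (i : V) : ℝ := ∫ x in D, φ i x

/-- Consistent mass `m_ij = ∫_D φ_i φ_j`. -/
def massC (i j : V) : ℝ := ∫ x in D, φ i x * φ j x

/-- `c_ij = ∫_D φ_i ∇φ_j`. -/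
def cvec (i j : V) : Vec d := ∫ x in D, φ i x • gradient (φ j) x

/-- `n_ij = c_ij / ‖c_ij‖`. -/
def nvec (i j : V) : Vec d := ‖cvec D φ i j‖⁻¹ • cvec D φ i j

open scoped Classical in
/-- `b_ij = δ_ij - m_ij / m_j`. -/
def bcoef (i j : V) : ℝ := (if i = j then 1 else 0) - massC D φ i j / mass D φ j

/-- `∫_{∂D} φ_i n ds`. -/
def boundaryVec (i : V) : Vec d := ∫ x, φ i x • outwardNormal D x ∂(surfaceMeasure D)

/-- Boundary mass `m_i^∂ = ‖∫_{∂D} φ_i n ds‖`. -/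
def boundaryMass (i : V) : ℝ := ‖boundaryVec D φ i‖

/-- Approximate normal `n_i = (∫_{∂D} φ_i n ds) / m_i^∂`. -/
def boundaryNormal (i : V) : Vec d := (boundaryMass D φ i)⁻¹ • boundaryVec D φ i

end Mesh

/-! ### The forward-Euler step

`D` is the domain, `φ` the shape functions, `p` the pressure, `lam` the bound on the wave speed,
`cfl` the CFL constant, `α` the entropy-production indicator, `γ` the exponent in the limiting
functional `Φ`, and `U` the collection of states at time `tⁿ`. -/

section Scheme

variable {V : Type*} [Fintype V] (D : Set (Vec d)) (φ : V → Vec d → ℝ) (p : State d → ℝ)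
  (lam : State d → State d → Vec d → ℝ) (cfl : ℝ) (α : V → ℝ) (γ : ℝ) (U : V → State d)

/-- The graph viscosity for `i ≠ j`. -/
def viscOff (i j : V) : ℝ :=
  max (lam (U i) (U j) (nvec D φ i j) * ‖cvec D φ i j‖)
      (lam (U j) (U i) (nvec D φ j i) * ‖cvec D φ j i‖)

open scoped Classical in
/-- The low-order graph viscosity `d_ij^L`, with `d_ii^L = - ∑_{j ∈ I*(i)} d_ij^L`. -/
def viscL (i j : V) : ℝ :=
  if i = j then - ∑ k ∈ stencilStar D φ i, viscOff D φ lam U i k else viscOff D φ lam U i j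

/-- The time step `τ_n = c_cfl min_i (- m_i / (2 d_ii^L))`. An index with `d_ii^L = 0` imposes no
restriction and is left out of the minimum. -/
def timeStep : ℝ :=
  cfl * sInf ((fun i => - mass D φ i / (2 * viscL D φ lam U i i)) ''
    {i : V | viscL D φ lam U i i ≠ 0})

/-- Low-order fluxes `F_ij^L = - f(U_j) c_ij + d_ij^L (U_j - U_i)`. -/
def fluxL (i j : V) : State d :=
  - flux p (U j) (cvec D φ i j) + viscL D φ lam U i j • (U j - U i)

/-- The low-order update `U^{L,n+1}`. -/
def lowOrder (i : V) : State d :=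
  U i + (timeStep D φ lam cfl U / mass D φ i) • ∑ j ∈ stencil D φ i, fluxL D φ p lam U i j

/-- The auxiliary states; if `d_ij^L = 0` then `c_ij = 0` and the second term is absent. -/
def barState (i j : V) : State d :=
  (1 / 2 : ℝ) • (U i + U j) - (1 / (2 * viscL D φ lam U i j)) •
    (flux p (U j) (cvec D φ i j) - flux p (U i) (cvec D φ i j))

/-- The high-order graph viscosity `d_ij^H = (α_i + α_j) / 2 * d_ij^L`. -/
def viscH (i j : V) : ℝ := (α i + α j) / 2 * viscL D φ lam U i j

/-- High-order fluxes `F_i^H = ∑_{j ∈ I(i)} (- f(U_j) c_ij + d_ij^H (U_j - U_i))`. -/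
def fluxH (i : V) : State d :=
  ∑ j ∈ stencil D φ i,
    (- flux p (U j) (cvec D φ i j) + viscH D φ lam α U i j • (U j - U i))

/-- `λ_i = (card I(i) - 1)⁻¹`. -/
def weight (i : V) : ℝ := (((stencil D φ i).card : ℝ) - 1)⁻¹

/-- `P_ij = τ_n / (m_i λ_i) (b_ij F_j^H - b_ji F_i^H + (d_ij^H - d_ij^L) (U_j - U_i))`. -/
def increment (i j : V) : State d :=
  (timeStep D φ lam cfl U / (mass D φ i * weight D φ i)) •
    (bcoef D φ i j • fluxH D φ p lam α U j - bcoef D φ j i • fluxH D φ p lam α U i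
      + (viscH D φ lam α U i j - viscL D φ lam U i j) • (U j - U i))

/-- The functionals to be limited: `Ψ_♭(u) = ρ`. -/
def psiFlat (u : State d) : ℝ := rho u

/-- `Ψ_♯(u) = - ρ`. -/
def psiSharp (u : State d) : ℝ := - rho u

/-- `Φ(u) = ε(u) ρ^{-γ}`. -/
def phiEntropy (u : State d) : ℝ := internalEnergy u * rho u ^ (-γ)

/-- `Ψ_{♭,i}^min`, the minimum of `Ψ_♭` over the auxiliary states `Ū_ij`, `j ∈ I(i)`. -/
def psiFlatMin (i : V) : ℝ :=
  sInf ((fun j => psiFlat (barState D φ p lam U i j)) '' (stencil D φ i : Set V))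

/-- `Ψ_{♯,i}^min`, the minimum of `Ψ_♯` over the auxiliary states `Ū_ij`, `j ∈ I(i)`. -/
def psiSharpMin (i : V) : ℝ :=
  sInf ((fun j => psiSharp (barState D φ p lam U i j)) '' (stencil D φ i : Set V))

/-- `Φ_i^min`, the minimum of `Φ` over the states `U_j`, `j ∈ I(i)`. -/
def phiMin (i : V) : ℝ :=
  sInf ((fun j => phiEntropy γ (U j)) '' (stencil D φ i : Set V))

/-- The largest number `l` in `[0, 1]` such that the state `W + l P` satisfies the three bounds at
the node `i`. -/
def oneSidedLimiter (i : V) (W P : State d) : ℝ :=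
  sSup {l : ℝ | l ∈ Icc (0 : ℝ) 1 ∧
    psiFlatMin D φ p lam U i ≤ psiFlat (W + l • P) ∧
    psiSharpMin D φ p lam U i ≤ psiSharp (W + l • P) ∧
    phiMin D φ γ U i ≤ phiEntropy γ (W + l • P)}

/-- The symmetric limiter `l_ij = min(l_j^i, l_i^j)`, computed from the states `W` and the
increments `P`. -/
def limiter (W : V → State d) (P : V → V → State d) (i j : V) : ℝ :=
  min (oneSidedLimiter D φ p lam γ U i (W i) (P i j))
      (oneSidedLimiter D φ p lam γ U j (W j) (P j i))

/-- One pass of limiting: `W_i` becomes `W_i + ∑_{j ∈ I*(i)} λ_i l_ij P_ij`, and `P_ij` becomes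
`(1 - l_ij) P_ij`. -/
def limiterPass (WP : (V → State d) × (V → V → State d)) :
    (V → State d) × (V → V → State d) :=
  (fun i => WP.1 i + ∑ j ∈ stencilStar D φ i,
      (weight D φ i * limiter D φ p lam γ U WP.1 WP.2 i j) • WP.2 i j,
   fun i j => (1 - limiter D φ p lam γ U WP.1 WP.2 i j) • WP.2 i j)

/-- The update `U^{n+1}` after one forward-Euler step and `K` passes of limiting, which start from
the low-order update and the increments `P_ij`. -/
def eulerStep (K : ℕ) : V → State d :=
  ((limiterPass D φ p lam γ U)^[K]
    (lowOrder D φ p lam cfl U, increment D φ p lam cfl α U)).1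

end Scheme

end EulerFE

end

namespace EulerFE
open Filter Topology


/-! ### Coordinates adapted to a hyperplane -/

/-! Part (i) is linearity of the integral. Part (ii) splits into conservation and admissibility,
which are independent.

Conservation. Everything exchanged between two nodes cancels: the viscous terms by symmetry of
`d_ij`, and the limited increments because `m_i λ_i P_ij` is antisymmetric and `ℓ_ij` symmetric.
What remains is the column sum of the `c_ij`, which by the partition of unity is `∫_D ∇φ_j`, and the
divergence theorem turns it into `∫_{∂D} φ_j n ds` (`IsShapeFamily.sum_cvec_left`). The divergence
theorem is proved for Lipschitz `f` by differentiating translations: `∫_D (f(x + t v) - f(x)) / t`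
equals an integral of `f` against the difference of the indicators of `D + t v` and `D`. That
difference lives in layers of thickness `O(t)` along the finitely many hyperplanes containing `∂D`;
rescaling each layer and letting `t → 0` gives the surface integral, face by face
(`IsBoundaryArrangement.tendsto_integral_layer`).

Admissibility. Admissible states form a convex cone. For `s` at least the maximum wave speed, `s u_L
+ f(u_L) n` and `s u_R - f(u_R) n` are each admissible, because the gas then crosses the plane at
least at sound speed (`IsAdmissible.smul_add_flux`); no Riemann solution has to be constructed. So
the auxiliary states are admissible, and since `∑_j c_ij = 0`, the CFL condition makes the low-order
update a convex combination of them and `U_i`. Strict positivity of the wave speed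
(`maxWaveSpeed_pos`) ensures that `d_ij = 0` only if `c_ij = 0`. Finally, the limited states `W_i +
ℓ_ij P_ij` are admissible (`isAdmissible_add_smul`), and a pass of limiting averages them with
weights `λ_i`. -/

/-- For every unit vector `n` there are measure preserving coordinates in which `⟨n, ·⟩` is the
first coordinate and the remaining coordinates are isometric on the hyperplanes orthogonal to
`n`. -/
theorem exists_hyperplane_frame {m : ℕ} (n : Vec (m + 1)) (hn : ‖n‖ = 1) :
    ∃ Ψ : (ℝ × Vec m) ≃L[ℝ] Vec (m + 1), MeasurePreserving Ψ ∧
      (∀ z, inner ℝ n (Ψ z) = z.1) ∧ ∀ y, ‖Ψ (0, y)‖ = ‖y‖ := by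
  have key : ∀ (E : Type) [NormedAddCommGroup E] [InnerProductSpace ℝ E] [FiniteDimensional ℝ E],
      Module.finrank ℝ E = m + 1 → ∀ e : E, ‖e‖ = 1 →
      ∃ b : OrthonormalBasis (Fin (m + 1)) ℝ E, b 0 = e := by
    intro E _ _ _ hE e he
    obtain ⟨b, hb⟩ := Orthonormal.exists_orthonormalBasis_extension_of_card_eq
      (𝕜 := ℝ) (E := E) (ι := Fin (m + 1)) (by simpa using hE) (v := fun _ => e) (s := {0})
      (by
        constructor
        · intro i; simpa using he
        · intro i j hij
          exact absurd (Subsingleton.elim i j) hij)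
    exact ⟨b, hb 0 rfl⟩
  obtain ⟨b, hb⟩ := key (Vec (m + 1)) (by simp) n hn
  -- The plain product carries the sup norm. With the `L²` norm it is Euclidean, so matching
  -- orthonormal bases that start with `(1, 0)` and `n` gives a linear isometry sending `(1, 0)` to
  -- `n`.
  let e0 : WithLp 2 (ℝ × Vec m) := WithLp.toLp 2 (1, 0)
  have he0 : ‖e0‖ = 1 := by
    rw [WithLp.prod_norm_eq_of_L2]; simp [e0]
  obtain ⟨b', hb'⟩ := key (WithLp 2 (ℝ × Vec m))
    (by
      rw [(WithLp.linearEquiv 2 ℝ (ℝ × Vec m)).finrank_eq]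
      simp [add_comm]) e0 he0
  let A : WithLp 2 (ℝ × Vec m) ≃ₗᵢ[ℝ] Vec (m + 1) := b'.equiv b (Equiv.refl _)
  have hA : A e0 = n := by
    rw [← hb', ← hb]; exact b'.equiv_apply_basis b _ 0
  refine ⟨(WithLp.prodContinuousLinearEquiv 2 ℝ ℝ (Vec m)).symm.trans A.toContinuousLinearEquiv,
    ?_, ?_, ?_⟩
  · exact A.measurePreserving.comp (WithLp.volume_preserving_toLp ℝ (Vec m))
  · intro z
    change inner ℝ n (A (WithLp.toLp 2 z)) = z.1
    rw [← hA, A.inner_map_map, WithLp.prod_inner_apply]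
    simp [e0]
  · intro y
    change ‖A (WithLp.toLp 2 (0, y))‖ = ‖y‖
    rw [A.norm_map, WithLp.prod_norm_eq_of_L2]
    simp

section Frame

variable {m : ℕ} {n : Vec (m + 1)} {Ψ : (ℝ × Vec m) ≃L[ℝ] Vec (m + 1)}

theorem frame_add (c : ℝ) (y : Vec m) : Ψ (c, y) = Ψ (c, 0) + Ψ (0, y) := by
  rw [← map_add]; simp

theorem isometry_frame (hiso : ∀ y, ‖Ψ (0, y)‖ = ‖y‖) (c : ℝ) :
    Isometry fun y : Vec m => Ψ (c, y) := by
  refine Isometry.of_dist_eq fun y z => ?_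
  rw [dist_eq_norm, dist_eq_norm, ← map_sub, Prod.mk_sub_mk, sub_self, hiso]

theorem range_frame (hin : ∀ z, inner ℝ n (Ψ z) = z.1) (c : ℝ) :
    range (fun y : Vec m => Ψ (c, y)) = {x | inner ℝ n x = c} := by
  ext x
  constructor
  · rintro ⟨y, rfl⟩; exact hin _
  · intro hx
    refine ⟨(Ψ.symm x).2, ?_⟩
    have h := hin (Ψ.symm x)
    rw [Ψ.apply_symm_apply] at h
    have : (c, (Ψ.symm x).2) = Ψ.symm x := by
      ext1
      · exact hx.symm.trans h
      · rfl
    simp [this]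

/-- Hausdorff measure is carried along by isometric embeddings, and its normalization makes it
Lebesgue measure on `ℝ^m`. Surface integrals over a face thereby become ordinary integrals. -/
theorem map_frame_volume (hin : ∀ z, inner ℝ n (Ψ z) = z.1) (hiso : ∀ y, ‖Ψ (0, y)‖ = ‖y‖)
    (c : ℝ) : Measure.map (fun y : Vec m => Ψ (c, y)) volume =
      (Measure.euclideanHausdorffMeasure m : Measure (Vec (m + 1))).restrict
        {x | inner ℝ n x = c} := by
  rw [← range_frame hin c, ← (isometry_frame hiso c).map_euclideanHausdorffMeasure,
    EuclideanSpace.euclideanHausdorffMeasure_eq_volume]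

/-- Change of variables for the layer over the hyperplane `⟨n, ·⟩ = c` in the direction `v`. -/
theorem map_layer (hΨ : MeasurePreserving Ψ) (hin : ∀ z, inner ℝ n (Ψ z) = z.1) (c : ℝ)
    {v : Vec (m + 1)} {t : ℝ} (ht : t * inner ℝ n v ≠ 0) :
    Measure.map (fun z : ℝ × Vec m => Ψ (c, z.2) + (t * z.1) • v) volume =
      ENNReal.ofReal |(t * inner ℝ n v)⁻¹| • (volume : Measure (Vec (m + 1))) := by
  set w := Ψ.symm v with hw
  have hvw : Ψ w = v := Ψ.apply_symm_apply v
  have hw1 : inner ℝ n v = w.1 := by rw [← hvw, hin]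
  -- In frame coordinates the layer map is a shear along the hyperplane, which preserves volume,
  -- followed by an affine scaling of the first coordinate by `t ⟨n, v⟩`, the only source of the
  -- Jacobian.
  have e1 : MeasurePreserving (fun z : ℝ × Vec m => (z.1, z.2 + (t * z.1) • w.2))
      (volume.prod volume) (volume.prod volume) := by
    refine (MeasurePreserving.id (volume : Measure ℝ)).skew_product
      (g := fun (r : ℝ) (y : Vec m) => y + (t * r) • w.2) ?_ ?_
    · unfold Function.uncurry; fun_prop
    · exact Eventually.of_forall fun r => (measurePreserving_add_right volume _).map_eq
  have e2 : Measure.map (fun s : ℝ => c + (t * inner ℝ n v) * s) volume =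
      ENNReal.ofReal |(t * inner ℝ n v)⁻¹| • volume := by
    have : (fun s : ℝ => c + (t * inner ℝ n v) * s) =
        (fun s => c + s) ∘ fun s => (t * inner ℝ n v) * s := rfl
    rw [this, ← Measure.map_map (by fun_prop) (by fun_prop), Real.map_volume_mul_left ht,
      Measure.map_smul, (measurePreserving_add_left volume c).map_eq]
  have e3 : Measure.map (Prod.map (fun s : ℝ => c + (t * inner ℝ n v) * s) (id : Vec m → Vec m))
      (volume.prod volume) =
      ENNReal.ofReal |(t * inner ℝ n v)⁻¹| • (volume.prod volume) := by
    rw [← Measure.map_prod_map _ _ (by fun_prop) measurable_id, e2, Measure.map_id,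
      Measure.prod_smul_left]
  have e4 : (fun z : ℝ × Vec m => Ψ (c, z.2) + (t * z.1) • v) =
      Ψ ∘ (Prod.map (fun s : ℝ => c + (t * inner ℝ n v) * s) (id : Vec m → Vec m)) ∘
        fun z : ℝ × Vec m => (z.1, z.2 + (t * z.1) • w.2) := by
    funext z
    simp only [Function.comp, Prod.map, id]
    rw [← hvw, ← map_smul, ← map_add]
    congr 1
    ext1
    · simp [hin]; ring
    · simp
  rw [e4, ← Measure.map_map Ψ.continuous.measurable (by fun_prop),
    ← Measure.map_map (by fun_prop) (by fun_prop), Measure.volume_eq_prod, e1.map_eq, e3,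
    Measure.map_smul, ← Measure.volume_eq_prod, hΨ.map_eq]

theorem integral_layer (hΨ : MeasurePreserving Ψ) (hin : ∀ z, inner ℝ n (Ψ z) = z.1) (c : ℝ)
    {v : Vec (m + 1)} {t : ℝ} (ht : t * inner ℝ n v ≠ 0) {g : Vec (m + 1) → ℝ}
    (hg : Measurable g) :
    ∫ x, g x = |t * inner ℝ n v| * ∫ z : ℝ × Vec m, g (Ψ (c, z.2) + (t * z.1) • v) := by
  have hm : Measurable fun z : ℝ × Vec m => Ψ (c, z.2) + (t * z.1) • v := by
    have := Ψ.continuous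
    fun_prop
  rw [← integral_map hm.aemeasurable hg.aestronglyMeasurable, map_layer hΨ hin c ht,
    integral_smul_measure, ENNReal.toReal_ofReal (abs_nonneg _), smul_eq_mul, ← mul_assoc,
    ← abs_mul, mul_inv_cancel₀ ht, abs_one, one_mul]

end Frame

/-- A level set of a linear functional that is not everything is a null set. -/
theorem volume_level_set_eq_zero {k : ℕ} (L : Vec k →ₗ[ℝ] ℝ) (b : ℝ)
    (h : {y : Vec k | L y = b} ≠ univ) : volume {y : Vec k | L y = b} = 0 := by
  rcases eq_empty_or_nonempty {y : Vec k | L y = b} with he | ⟨y₀, hy₀⟩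
  · rw [he]; simp
  · have hk : LinearMap.ker L ≠ ⊤ := by
      intro hk
      refine h (eq_univ_of_forall fun y => ?_)
      have h0 : L = 0 := LinearMap.ker_eq_top.1 hk
      simp only [mem_ofPred_eq, h0, LinearMap.zero_apply] at hy₀ ⊢
      exact hy₀
    have := measure_preimage_add volume (-y₀) (LinearMap.ker L : Set (Vec k))
    rw [Measure.addHaar_submodule _ _ hk] at this
    rw [← this]
    congr 1
    ext y
    rw [mem_ofPred_eq] at hy₀
    rw [mem_ofPred_eq, Set.mem_preimage, SetLike.mem_coe, LinearMap.mem_ker, map_add, map_neg, hy₀]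
    constructor <;> intro h <;> linarith

theorem volume_hyperplane_eq_zero {k : ℕ} {n : Vec k} (hn : ‖n‖ = 1) (c : ℝ) :
    volume {x : Vec k | inner ℝ n x = c} = 0 := by
  refine volume_level_set_eq_zero (innerₛₗ ℝ n) c fun h => ?_
  have h1 : (innerₛₗ ℝ n) ((c + 1) • n) = c := h.ge (mem_univ _)
  simp [hn] at h1

/-- From the point `c n`, a step along the part of `n'` orthogonal to `n` stays in the first
hyperplane, hence in the second. So that part is orthogonal to `n'` as well and vanishes: the
normals are parallel. -/
theorem hyperplane_eq_of_subset {k : ℕ} {n n' : Vec k} (hn : ‖n‖ = 1) (hn' : ‖n'‖ = 1) {c c' : ℝ}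
    (h : {x : Vec k | inner ℝ n x = c} ⊆ {x | inner ℝ n' x = c'}) :
    {x : Vec k | inner ℝ n x = c} = {x | inner ℝ n' x = c'} := by
  have hnn : inner ℝ n n = (1 : ℝ) := by rw [real_inner_self_eq_norm_sq, hn]; norm_num
  set a : ℝ := inner ℝ n n' with ha
  have h1 : inner ℝ n' (c • n) = c' := h (by simp [inner_smul_right, hn])
  have h2 : inner ℝ n' (c • n + (n' - a • n)) = c' := h (by
    simp [inner_smul_right, inner_add_right, inner_sub_right, hn, ha])
  rw [inner_add_right, h1] at h2
  have hna : inner ℝ n (n' - a • n) = (0 : ℝ) := by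
    simp [inner_smul_right, inner_sub_right, hn, ha]
  have h3 : inner ℝ (n' - a • n) (n' - a • n) = (0 : ℝ) := by
    rw [inner_sub_left, inner_smul_left, hna]
    simp
    linarith
  have h4 : n' = a • n := sub_eq_zero.1 (inner_self_eq_zero.1 h3)
  have ha0 : a ≠ 0 := by
    rintro h0; rw [h4, h0] at hn'; simp at hn'
  have hc : c' = a * c := by
    rw [← h1, inner_smul_right, real_inner_comm, ← ha]; ring
  ext x
  simp only [mem_ofPred_eq]
  rw [h4, hc, inner_smul_left]
  simp [ha0]

/-- Inside a hyperplane, a different hyperplane is a null set. -/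
theorem volume_frame_hyperplane_eq_zero {m : ℕ} {n n' : Vec (m + 1)}
    {Ψ : (ℝ × Vec m) ≃L[ℝ] Vec (m + 1)} (hn : ‖n‖ = 1) (hn' : ‖n'‖ = 1) {c c' : ℝ}
    (hin : ∀ z, inner ℝ n (Ψ z) = z.1)
    (h : {x : Vec (m + 1) | inner ℝ n x = c} ≠ {x | inner ℝ n' x = c'}) :
    volume {y : Vec m | inner ℝ n' (Ψ (c, y)) = c'} = 0 := by
  let L : Vec m →ₗ[ℝ] ℝ :=
    (innerₛₗ ℝ n') ∘ₗ (Ψ : (ℝ × Vec m) →ₗ[ℝ] Vec (m + 1)) ∘ₗ LinearMap.inr ℝ ℝ (Vec m)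
  have hL : ∀ y, L y = inner ℝ n' (Ψ (0, y)) := fun y => rfl
  have hset : {y : Vec m | inner ℝ n' (Ψ (c, y)) = c'} =
      {y | L y = c' - inner ℝ n' (Ψ (c, 0))} := by
    ext y
    simp only [mem_ofPred_eq, hL]
    rw [frame_add, inner_add_right]
    constructor <;> intro h <;> linarith
  rw [hset]
  refine volume_level_set_eq_zero L _ fun hu => h (hyperplane_eq_of_subset hn hn' ?_)
  rw [← hset] at hu
  rw [← range_frame hin c]
  rintro x ⟨y, rfl⟩
  exact hu.ge (mem_univ y)


/-! ### Local structure of the domain at a flat boundary point -/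

section Local

variable {d : ℕ} {D : Set (Vec d)}

/-- Off the frontier the space is the disjoint union of the open sets `D` and `(closure D)ᶜ`, and a
connected set lies in one of them. -/
theorem subset_or_disjoint_of_disjoint_frontier (hDo : IsOpen D) {S : Set (Vec d)}
    (hS : IsPreconnected S) (h : ∀ x ∈ S, x ∉ frontier D) : S ⊆ D ∨ ∀ x ∈ S, x ∉ D := by
  have hcov : S ⊆ D ∪ (closure D)ᶜ := by
    intro x hx
    by_cases hxD : x ∈ D
    · exact Or.inl hxD
    · right
      intro hxc
      exact h x hx ⟨hxc, by rwa [hDo.interior_eq]⟩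
  have hdis : Disjoint D (closure D)ᶜ :=
    Set.disjoint_left.2 fun x hx hx' => hx' (subset_closure hx)
  rcases hS.subset_or_subset hDo isClosed_closure.isOpen_compl hdis hcov with h1 | h1
  · exact Or.inl h1
  · exact Or.inr fun x hx hxD => h1 hx (subset_closure hxD)

theorem IsOutwardNormal.mem_frontier (hDo : IsOpen D) {x n : Vec d} (h : IsOutwardNormal D x n) :
    x ∈ frontier D := by
  obtain ⟨hn, r, hr, hball⟩ := h
  refine ⟨?_, ?_⟩
  · rw [Metric.mem_closure_iff]
    intro ε hε
    have hδ : 0 < min ε r / 2 := by positivity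
    have hdist : dist x (x - (min ε r / 2) • n) = min ε r / 2 := by
      rw [dist_eq_norm, sub_sub_cancel, norm_smul, hn, mul_one, Real.norm_of_nonneg hδ.le]
    refine ⟨x - (min ε r / 2) • n, (hball _ ?_).2 ?_, ?_⟩
    · rw [Metric.mem_ball, dist_comm, hdist]
      linarith [min_le_right ε r]
    · rw [sub_sub_cancel_left, inner_neg_left, inner_smul_left, real_inner_self_eq_norm_sq, hn]
      simpa using hδ
    · rw [hdist]; linarith [min_le_left ε r]
  · rw [hDo.interior_eq]
    intro hx
    have := (hball x (Metric.mem_ball_self hr)).1 hx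
    simp at this

/-- Needed because `outwardNormal` is a choice. By scaling, both normals define the same open
half-space. Testing it on `-n'` gives `⟨n', n⟩ > 0`, and testing it on `±(n' - ⟨n', n⟩ n)` gives
`⟨n', n⟩ = 1`. -/
theorem IsOutwardNormal.unique {x n n' : Vec d} (h : IsOutwardNormal D x n)
    (h' : IsOutwardNormal D x n') : n = n' := by
  obtain ⟨hn, r, hr, hball⟩ := h
  obtain ⟨hn', r', hr', hball'⟩ := h'
  have key : ∀ y : Vec d, inner ℝ y n < 0 ↔ inner ℝ y n' < 0 := by
    intro y
    obtain ⟨δ, hδ, hδy⟩ : ∃ δ : ℝ, 0 < δ ∧ δ * ‖y‖ < min r r' := by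
      refine ⟨min r r' / (‖y‖ + 1), by positivity, ?_⟩
      have h0 : 0 < min r r' := lt_min hr hr'
      rw [div_mul_eq_mul_div, div_lt_iff₀ (by positivity)]
      nlinarith [norm_nonneg y]
    have hmem : ∀ ρ, min r r' ≤ ρ → x + δ • y ∈ Metric.ball x ρ := by
      intro ρ hρ
      rw [Metric.mem_ball, dist_eq_norm, add_sub_cancel_left, norm_smul, Real.norm_of_nonneg hδ.le]
      linarith
    have e1 := hball _ (hmem r (min_le_left _ _))
    have e2 := hball' _ (hmem r' (min_le_right _ _))
    rw [add_sub_cancel_left, inner_smul_left] at e1 e2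
    have e3 := e1.symm.trans e2
    simp only [conj_trivial] at e3
    have hs : ∀ s : ℝ, δ * s < 0 ↔ s < 0 := fun s =>
      ⟨fun h => by by_contra hh; linarith [mul_nonneg hδ.le (not_lt.1 hh)],
        fun h => mul_neg_of_pos_of_neg hδ h⟩
    rwa [hs, hs] at e3
  have hnn : inner ℝ n n = (1 : ℝ) := by rw [real_inner_self_eq_norm_sq, hn]; norm_num
  have hnn' : inner ℝ n' n' = (1 : ℝ) := by rw [real_inner_self_eq_norm_sq, hn']; norm_num
  set a : ℝ := inner ℝ n' n with ha
  have hapos : 0 < a := by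
    have := (key (-n')).2 (by rw [inner_neg_left, hnn']; norm_num)
    rw [inner_neg_left] at this
    linarith
  have hw0 : inner ℝ (n' - a • n) n = (0 : ℝ) := by
    rw [inner_sub_left, inner_smul_left, hnn]; simp [ha]
  have hw1 : inner ℝ (n' - a • n) n' = 1 - a ^ 2 := by
    rw [inner_sub_left, inner_smul_left, hnn', real_inner_comm, ← ha]; simp; ring
  have h1 : ¬ inner ℝ (n' - a • n) n' < (0 : ℝ) := by rw [← key, hw0]; simp
  have h2 : ¬ inner ℝ (-(n' - a • n)) n' < (0 : ℝ) := by
    rw [← key, inner_neg_left, hw0]; simp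
  rw [inner_neg_left, hw1] at h2
  rw [hw1] at h1
  have ha1 : a = 1 := by nlinarith
  exact ((inner_eq_one_iff_of_norm_eq_one hn' hn).1 (ha ▸ ha1)).symm

/-- The outward normal on the boundary, extended by zero. -/
noncomputable def faceNormal (D : Set (Vec d)) (x : Vec d) : Vec d := (frontier D).indicator (outwardNormal D) x

theorem IsOutwardNormal.faceNormal_eq (hDo : IsOpen D) {x n : Vec d} (h : IsOutwardNormal D x n) :
    faceNormal D x = n := by
  rw [faceNormal, indicator_of_mem (h.mem_frontier hDo), outwardNormal, dif_pos ⟨n, h⟩]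
  exact (Exists.choose_spec (⟨n, h⟩ : ∃ n, IsOutwardNormal D x n)).unique h

/-- Moving from a point of a ball slightly in the direction `n`, we stay in any neighbourhood. -/
theorem exists_shift_mem {n z : Vec d} {U : Set (Vec d)} (hU : IsOpen U) (hz : z ∈ U) :
    ∃ δ > 0, z + (δ : ℝ) • n ∈ U := by
  have h : Tendsto (fun δ : ℝ => z + δ • n) (𝓝[>] 0) (𝓝 z) := by
    have : Tendsto (fun δ : ℝ => z + δ • n) (𝓝 0) (𝓝 (z + (0 : ℝ) • n)) :=
      Continuous.tendsto (by fun_prop) 0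
    rw [zero_smul, add_zero] at this
    exact this.mono_left nhdsWithin_le_nhds
  obtain ⟨δ, hδ, hδ'⟩ := ((h.eventually (hU.mem_nhds hz)).and self_mem_nhdsWithin).exists
  exact ⟨δ, hδ', hδ⟩

/-- If the domain is, near `x`, exactly on the negative side of the hyperplane through `x`
orthogonal to `n`, then `n` is the outward normal. -/
theorem isOutwardNormal_of_halves (hDo : IsOpen D) {n x : Vec d} (hn : ‖n‖ = 1) {r : ℝ}
    (hr : 0 < r) (h1 : ∀ y ∈ Metric.ball x r, inner ℝ n (y - x) < 0 → y ∈ D)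
    (h2 : ∀ y ∈ Metric.ball x r, 0 < inner ℝ n (y - x) → y ∉ D) : IsOutwardNormal D x n := by
  refine ⟨hn, r, hr, fun y hy => ⟨fun hyD => ?_, fun h => h1 y hy (by rwa [real_inner_comm])⟩⟩
  rw [real_inner_comm]
  by_contra hle
  push Not at hle
  -- A point of `D` on the hyperplane, or beyond it, could be pushed slightly to the positive side
  -- within the open set `D`, where there are no points of `D`.
  obtain ⟨δ, hδ, hz⟩ := exists_shift_mem (n := n) (hDo.inter Metric.isOpen_ball) ⟨hyD, hy⟩
  refine h2 _ hz.2 ?_ hz.1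
  rw [add_sub_right_comm, inner_add_right, inner_smul_right, real_inner_self_eq_norm_sq, hn]
  nlinarith

/-- Each open half-ball avoids the frontier, so the indicator is constant there. If both halves are
inside, `int (closure D) = D` makes `x` an interior point; if both are outside, `x` is not in the
closure. In each of the four cases the normal equals the jump of the indicator times `n`, so no case
distinction is needed later. -/
theorem exists_traces (hDo : IsOpen D) (hint : interior (closure D) = D) {n x : Vec d}
    (hn : ‖n‖ = 1) {r : ℝ} (hr : 0 < r)
    (hfr : ∀ y ∈ Metric.ball x r, y ∈ frontier D → inner ℝ n (y - x) = (0 : ℝ)) :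
    ∃ a b : ℝ, (∀ y ∈ Metric.ball x r, inner ℝ n (y - x) < 0 → D.indicator 1 y = a) ∧
      (∀ y ∈ Metric.ball x r, 0 < inner ℝ n (y - x) → D.indicator 1 y = b) ∧
      faceNormal D x = (a - b) • n := by
  have hconv1 : IsPreconnected (Metric.ball x r ∩ {y | inner ℝ n (y - x) < (0 : ℝ)}) := by
    refine ((convex_ball x r).inter ?_).isPreconnected
    have : {y | inner ℝ n (y - x) < (0 : ℝ)} = {y | innerₛₗ ℝ n y < inner ℝ n x} := by
      ext y; simp [inner_sub_right]
    rw [this]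
    exact convex_halfSpace_lt (innerₛₗ ℝ n).isLinear _
  have hconv2 : IsPreconnected (Metric.ball x r ∩ {y | (0 : ℝ) < inner ℝ n (y - x)}) := by
    refine ((convex_ball x r).inter ?_).isPreconnected
    have : {y | (0 : ℝ) < inner ℝ n (y - x)} = {y | inner ℝ n x < innerₛₗ ℝ n y} := by
      ext y; simp [inner_sub_right]
    rw [this]
    exact convex_halfSpace_gt (innerₛₗ ℝ n).isLinear _
  have d1 := subset_or_disjoint_of_disjoint_frontier hDo hconv1
    (fun y hy hf => hy.2.ne (hfr y hy.1 hf))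
  have d2 := subset_or_disjoint_of_disjoint_frontier hDo hconv2
    (fun y hy hf => hy.2.ne' (hfr y hy.1 hf))
  rcases d1 with d1 | d1 <;> rcases d2 with d2 | d2
  · refine ⟨1, 1, fun y hy h => indicator_of_mem (d1 ⟨hy, h⟩) _,
      fun y hy h => indicator_of_mem (d2 ⟨hy, h⟩) _, ?_⟩
    have hx : x ∈ interior (closure D) := by
      rw [mem_interior]
      refine ⟨Metric.ball x r, fun y hy => ?_, Metric.isOpen_ball, Metric.mem_ball_self hr⟩
      rw [mem_closure_iff]
      intro U hU hyU
      rcases lt_or_ge (inner ℝ n (y - x)) (0 : ℝ) with hlt | hge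
      · exact ⟨y, hyU, d1 ⟨hy, hlt⟩⟩
      · obtain ⟨δ, hδ, hz⟩ := exists_shift_mem (n := n) (hU.inter Metric.isOpen_ball) ⟨hyU, hy⟩
        refine ⟨_, hz.1, d2 ⟨hz.2, ?_⟩⟩
        simp only [mem_ofPred_eq]
        rw [add_sub_right_comm, inner_add_right, inner_smul_right, real_inner_self_eq_norm_sq, hn]
        nlinarith
    rw [hint] at hx
    rw [faceNormal, indicator_of_notMem, sub_self, zero_smul]
    intro hf
    exact hf.2 (by rwa [hDo.interior_eq])
  · refine ⟨1, 0, fun y hy h => indicator_of_mem (d1 ⟨hy, h⟩) _,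
      fun y hy h => indicator_of_notMem (d2 _ ⟨hy, h⟩) _, ?_⟩
    rw [(isOutwardNormal_of_halves hDo hn hr (fun y hy h => d1 ⟨hy, h⟩)
      (fun y hy h => d2 _ ⟨hy, h⟩)).faceNormal_eq hDo]
    simp
  · refine ⟨0, 1, fun y hy h => indicator_of_notMem (d1 _ ⟨hy, h⟩) _,
      fun y hy h => indicator_of_mem (d2 ⟨hy, h⟩) _, ?_⟩
    rw [(isOutwardNormal_of_halves (n := -n) hDo (by rwa [norm_neg]) hr
      (fun y hy h => d2 ⟨hy, by rw [inner_neg_left] at h; exact neg_lt_zero.1 h⟩)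
      (fun y hy h => d1 _ ⟨hy, by rw [inner_neg_left] at h; exact neg_pos.1 h⟩)).faceNormal_eq hDo]
    simp
  · refine ⟨0, 0, fun y hy h => indicator_of_notMem (d1 _ ⟨hy, h⟩) _,
      fun y hy h => indicator_of_notMem (d2 _ ⟨hy, h⟩) _, ?_⟩
    rw [faceNormal, indicator_of_notMem, sub_self, zero_smul]
    intro hf
    obtain ⟨z, hz, hzD⟩ := mem_closure_iff.1 hf.1 _ Metric.isOpen_ball (Metric.mem_ball_self hr)
    rcases lt_or_ge (inner ℝ n (z - x)) (0 : ℝ) with hlt | hge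
    · exact d1 z ⟨hz, hlt⟩ hzD
    · obtain ⟨δ, hδ, hw⟩ := exists_shift_mem (n := n) (hDo.inter Metric.isOpen_ball) ⟨hzD, hz⟩
      refine d2 _ ⟨hw.2, ?_⟩ hw.1
      simp only [mem_ofPred_eq]
      rw [add_sub_right_comm, inner_add_right, inner_smul_right, real_inner_self_eq_norm_sq, hn]
      nlinarith

theorem exists_mem_segment_frontier (hDo : IsOpen D) {x y : Vec d}
    (h : ¬ (x ∈ D ↔ y ∈ D)) : ∃ z ∈ segment ℝ x y, z ∈ frontier D := by
  by_contra hc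
  push Not at hc
  rcases subset_or_disjoint_of_disjoint_frontier hDo (convex_segment x y).isPreconnected hc
    with h1 | h1
  · exact h (iff_of_true (h1 (left_mem_segment ℝ x y)) (h1 (right_mem_segment ℝ x y)))
  · exact h (iff_of_false (h1 _ (left_mem_segment ℝ x y)) (h1 _ (right_mem_segment ℝ x y)))

end Local


/-! ### Arrangements of hyperplanes that contain the boundary -/

/-- The boundary of `D` is contained in the union of the pairwise distinct hyperplanes
`⟨n i, ·⟩ = c i` with unit normals `n i`. -/
structure IsBoundaryArrangement {d : ℕ} {ι : Type*} (D : Set (Vec d)) (n : ι → Vec d)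
    (c : ι → ℝ) : Prop where
  norm_eq : ∀ i, ‖n i‖ = 1
  ne : ∀ i j, i ≠ j → {x : Vec d | inner ℝ (n i) x = c i} ≠ {x | inner ℝ (n j) x = c j}
  subset : frontier D ⊆ ⋃ i, {x | inner ℝ (n i) x = c i}

theorem IsPolyhedralDomain.exists_arrangement {d : ℕ} {D : Set (Vec d)}
    (hD : IsPolyhedralDomain D) :
    ∃ (ι : Type) (_ : Fintype ι) (n : ι → Vec d) (c : ι → ℝ), IsBoundaryArrangement D n c := by
  classical
  obtain ⟨H, hH, hsub⟩ := hD.frontier_subset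
  -- Indexing by the hyperplanes as sets, rather than by their equations, merges proportional
  -- equations and makes the hyperplanes pairwise distinct.
  let S : Finset (Set (Vec d)) := H.image fun h => {x : Vec d | inner ℝ h.1 x = h.2}
  have hS : ∀ s : S, ∃ (n : Vec d) (c : ℝ), ‖n‖ = 1 ∧ {x : Vec d | inner ℝ n x = c} = s.1 := by
    rintro ⟨s, hs⟩
    obtain ⟨h, hh, rfl⟩ := Finset.mem_image.1 hs
    have h0 : ‖h.1‖ ≠ 0 := norm_ne_zero_iff.2 (hH h hh)
    refine ⟨‖h.1‖⁻¹ • h.1, ‖h.1‖⁻¹ * h.2, ?_, ?_⟩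
    · rw [norm_smul, norm_inv, norm_norm, inv_mul_cancel₀ h0]
    · ext x
      simp [inner_smul_left, h0]
  choose n c hn hc using hS
  refine ⟨S, inferInstance, n, c, hn, fun i j hij h => hij ?_, fun x hx => ?_⟩
  · rw [hc, hc] at h
    exact Subtype.ext h
  · obtain ⟨h, hh, hxh⟩ := mem_iUnion₂.1 (hsub hx)
    refine mem_iUnion.2 ⟨⟨_, Finset.mem_image_of_mem _ hh⟩, ?_⟩
    rw [hc]; exact hxh

/-- Weights that distribute a function over a finite family of sets that cover its support. -/
noncomputable def coverWeight {ι X : Type*} [Fintype ι] (S : ι → Set X) (i : ι) (x : X) : ℝ :=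
  (S i).indicator 1 x / ∑ k, (S k).indicator 1 x

section CoverWeight

variable {ι X : Type*} [Fintype ι] {S : ι → Set X} {i : ι} {x : X}

theorem indicator_one_nonneg (A : Set X) (x : X) : 0 ≤ A.indicator (1 : X → ℝ) x :=
  indicator_nonneg (fun _ _ => zero_le_one) x

theorem coverWeight_nonneg : 0 ≤ coverWeight S i x :=
  div_nonneg (indicator_one_nonneg _ _) (Finset.sum_nonneg fun _ _ => indicator_one_nonneg _ _)

theorem coverWeight_le_one : coverWeight S i x ≤ 1 :=
  div_le_one_of_le₀
    (Finset.single_le_sum (f := fun k => (S k).indicator (1 : X → ℝ) x)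
      (fun _ _ => indicator_one_nonneg _ _) (Finset.mem_univ i))
    (Finset.sum_nonneg fun _ _ => indicator_one_nonneg _ _)

theorem coverWeight_of_notMem (h : x ∉ S i) : coverWeight S i x = 0 := by
  rw [coverWeight, indicator_of_notMem h, zero_div]

theorem sum_coverWeight (h : x ∈ S i) : ∑ k, coverWeight S k x = 1 := by
  unfold coverWeight
  rw [← Finset.sum_div]
  refine div_self (ne_of_gt ?_)
  refine Finset.sum_pos' (fun _ _ => indicator_one_nonneg _ _) ⟨i, Finset.mem_univ i, ?_⟩
  rw [indicator_of_mem h]; exact zero_lt_one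

theorem coverWeight_eq_one (h : x ∈ S i) (h' : ∀ k, k ≠ i → x ∉ S k) : coverWeight S i x = 1 := by
  rw [← sum_coverWeight h]
  exact (Finset.sum_eq_single i (fun k _ hk => coverWeight_of_notMem (h' k hk))
    (fun hi => absurd (Finset.mem_univ i) hi)).symm

theorem measurable_coverWeight [MeasurableSpace X] (hS : ∀ k, MeasurableSet (S k)) (i : ι) :
    Measurable (coverWeight S i) := by
  unfold coverWeight
  have h : ∀ k, Measurable ((S k).indicator (1 : X → ℝ)) := fun k =>
    measurable_one.indicator (hS k)
  exact (h i).div (Finset.measurable_sum _ fun k _ => h k)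

end CoverWeight

/-- The points `y + s v`, `0 ≤ s ≤ t`, with `y` in the hyperplane `⟨n, ·⟩ = c`; empty if `v` is
parallel to the hyperplane. -/
def layer {d : ℕ} (n : Vec d) (c : ℝ) (v : Vec d) (t : ℝ) : Set (Vec d) :=
  {x | inner ℝ n v ≠ (0 : ℝ) ∧ (inner ℝ n x - c) / inner ℝ n v ∈ Icc 0 t}

theorem measurableSet_layer {d : ℕ} (n : Vec d) (c : ℝ) (v : Vec d) (t : ℝ) :
    MeasurableSet (layer n c v t) := by
  refine (MeasurableSet.const _).inter ?_
  exact measurableSet_Icc.preimage (by fun_prop)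

theorem integrable_mul_indicator {d : ℕ} {f : Vec d → ℝ} (hf : Continuous f) {A : Set (Vec d)}
    (hA : MeasurableSet A) (hb : Bornology.IsBounded A) :
    Integrable fun x => f x * A.indicator 1 x := by
  have h : IntegrableOn f A := by
    obtain ⟨R, hR⟩ := hb.subset_closedBall 0
    exact (hf.continuousOn.integrableOn_compact (isCompact_closedBall 0 R)).mono_set hR
  have h' := h.integrable_indicator hA
  refine h'.congr (Eventually.of_forall fun x => ?_)
  by_cases hx : x ∈ A <;> simp [hx]

theorem norm_faceNormal_le {d : ℕ} (D : Set (Vec d)) (x : Vec d) : ‖faceNormal D x‖ ≤ 1 := by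
  unfold faceNormal
  by_cases hx : x ∈ frontier D
  · rw [indicator_of_mem hx, outwardNormal]
    split_ifs with h
    · exact h.choose_spec.1.le
    · simp
  · rw [indicator_of_notMem hx]; simp

section Arrangement

variable {m : ℕ} {ι : Type*} [Fintype ι] {D : Set (Vec (m + 1))} {n : ι → Vec (m + 1)}
  {c : ι → ℝ} {Ψ : (ℝ × Vec m) ≃L[ℝ] Vec (m + 1)} {i : ι}

/-- Near a point lying on one hyperplane only, the frontier can meet only that hyperplane. -/
theorem IsBoundaryArrangement.exists_traces (hA : IsBoundaryArrangement D n c) (hDo : IsOpen D)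
    (hint : interior (closure D) = D) {x : Vec (m + 1)} (hx : inner ℝ (n i) x = c i)
    (hreg : ∀ j, j ≠ i → inner ℝ (n j) x ≠ c j) :
    ∃ r > 0, ∃ a b : ℝ,
      (∀ y ∈ Metric.ball x r, inner ℝ (n i) (y - x) < 0 → D.indicator 1 y = a) ∧
      (∀ y ∈ Metric.ball x r, 0 < inner ℝ (n i) (y - x) → D.indicator 1 y = b) ∧
      faceNormal D x = (a - b) • n i := by
  have hev : ∀ᶠ y in 𝓝 x, ∀ j, j ≠ i → inner ℝ (n j) y ≠ c j := by
    rw [eventually_all]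
    intro j
    by_cases hj : j = i
    · exact Eventually.of_forall fun y h => absurd hj h
    · have : Continuous fun y : Vec (m + 1) => inner ℝ (n j) y := by fun_prop
      filter_upwards [this.continuousAt.eventually_ne (hreg j hj)] with y hy _ using hy
  obtain ⟨r, hr, hball⟩ := Metric.eventually_nhds_iff_ball.1 hev
  refine ⟨r, hr, EulerFE.exists_traces hDo hint (hA.norm_eq i) hr fun y hy hyf => ?_⟩
  obtain ⟨j, hj⟩ := mem_iUnion.1 (hA.subset hyf)
  have hji : j = i := by
    by_contra hji
    exact hball y hy j hji hj
  subst hji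
  rw [inner_sub_right, hx]
  exact sub_eq_zero.2 hj

theorem IsBoundaryArrangement.ae_regular (hA : IsBoundaryArrangement D n c)
    (hin : ∀ z, inner ℝ (n i) (Ψ z) = z.1) :
    ∀ᵐ y : Vec m, ∀ j, j ≠ i → inner ℝ (n j) (Ψ (c i, y)) ≠ c j := by
  rw [eventually_countable_forall]
  intro j
  by_cases hj : j = i
  · exact Eventually.of_forall fun y h => absurd hj h
  · have := volume_frame_hyperplane_eq_zero (hA.norm_eq i) (hA.norm_eq j) hin
      (hA.ne i j (Ne.symm hj))
    filter_upwards [measure_eq_zero_iff_ae_notMem.1 this] with y hy _ using hy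

theorem tendsto_add_smul_nhdsGT {d : ℕ} (x w : Vec d) :
    Tendsto (fun t : ℝ => x + t • w) (𝓝[>] 0) (𝓝 x) := by
  have : Tendsto (fun δ : ℝ => x + δ • w) (𝓝 0) (𝓝 (x + (0 : ℝ) • w)) :=
    Continuous.tendsto (by fun_prop) 0
  rw [zero_smul, add_zero] at this
  exact this.mono_left nhdsWithin_le_nhds

/-- A normal field defined by choice is not visibly measurable. Almost everywhere on the face it is
the limit of differences of the indicator of `D` taken at the two sides of the hyperplane, and these
are measurable. -/
theorem IsBoundaryArrangement.aestronglyMeasurable_faceNormal (hA : IsBoundaryArrangement D n c)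
    (hDo : IsOpen D) (hint : interior (closure D) = D) (hin : ∀ z, inner ℝ (n i) (Ψ z) = z.1) :
    AEStronglyMeasurable (fun y : Vec m => faceNormal D (Ψ (c i, y))) volume := by
  have hχ : Measurable (D.indicator (1 : Vec (m + 1) → ℝ)) :=
    measurable_one.indicator hDo.measurableSet
  have hΨ := Ψ.continuous
  refine aestronglyMeasurable_of_tendsto_ae (𝓝[>] (0 : ℝ))
    (f := fun (t : ℝ) y => (D.indicator 1 (Ψ (c i, y) + t • (-n i)) -
      D.indicator 1 (Ψ (c i, y) + t • n i) : ℝ) • n i) (fun t => ?_) ?_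
  · refine Measurable.aestronglyMeasurable ?_
    refine Measurable.smul_const (Measurable.sub ?_ ?_) _
    · exact hχ.comp (by fun_prop)
    · exact hχ.comp (by fun_prop)
  · filter_upwards [hA.ae_regular hin] with y hy
    obtain ⟨r, hr, a, b, ha, hb, hN⟩ := hA.exists_traces hDo hint (hin (c i, y)) hy
    rw [hN]
    refine Tendsto.congr' ?_ tendsto_const_nhds
    have hnn : inner ℝ (n i) (n i) = (1 : ℝ) := by
      rw [real_inner_self_eq_norm_sq, hA.norm_eq]; norm_num
    filter_upwards [self_mem_nhdsWithin,
      (tendsto_add_smul_nhdsGT (Ψ (c i, y)) (-n i)).eventually (Metric.ball_mem_nhds _ hr),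
      (tendsto_add_smul_nhdsGT (Ψ (c i, y)) (n i)).eventually (Metric.ball_mem_nhds _ hr)]
      with t ht h1 h2
    have ht' : (0 : ℝ) < t := ht
    rw [ha _ h1, hb _ h2]
    · rw [add_sub_cancel_left, inner_smul_right, hnn]; linarith
    · rw [add_sub_cancel_left, inner_smul_right, inner_neg_right, hnn]; linarith

theorem norm_le_of_frame (hiso : ∀ y, ‖Ψ (0, y)‖ = ‖y‖) (s : ℝ) (y : Vec m) :
    ‖y‖ ≤ ‖Ψ (s, y)‖ + ‖Ψ (s, 0)‖ := by
  have : Ψ (0, y) = Ψ (s, y) - Ψ (s, 0) := by rw [frame_add s y]; abel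
  rw [← hiso, this]
  exact norm_sub_le _ _

theorem IsBoundaryArrangement.integrable_face (hA : IsBoundaryArrangement D n c)
    (hDo : IsOpen D) (hDb : Bornology.IsBounded D) (hint : interior (closure D) = D)
    (hin : ∀ z, inner ℝ (n i) (Ψ z) = z.1) (hiso : ∀ y, ‖Ψ (0, y)‖ = ‖y‖)
    {f : Vec (m + 1) → ℝ} (hf : Continuous f) :
    Integrable fun y : Vec m => f (Ψ (c i, y)) • faceNormal D (Ψ (c i, y)) := by
  have hΨ := Ψ.continuous
  have hfc : Continuous fun y : Vec m => f (Ψ (c i, y)) := by fun_prop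
  obtain ⟨R, hR⟩ := hDb.closure.subset_closedBall 0
  set R' := R + ‖Ψ (c i, 0)‖ with hR'
  have h0 : IntegrableOn (fun y : Vec m => f (Ψ (c i, y))) (Metric.closedBall 0 R') :=
    hfc.continuousOn.integrableOn_compact (isCompact_closedBall 0 R')
  have h1 := h0.integrable_indicator Metric.isClosed_closedBall.measurableSet
  refine h1.mono (hfc.aestronglyMeasurable.smul
    (hA.aestronglyMeasurable_faceNormal hDo hint hin)) (Eventually.of_forall fun y => ?_)
  by_cases hy : Ψ (c i, y) ∈ frontier D
  · have hmem : y ∈ Metric.closedBall (0 : Vec m) R' := by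
      rw [mem_closedBall_zero_iff]
      have := hR hy.1
      rw [mem_closedBall_zero_iff] at this
      linarith [norm_le_of_frame hiso (c i) y]
    rw [indicator_of_mem hmem, norm_smul]
    exact mul_le_of_le_one_right (norm_nonneg _) (norm_faceNormal_le _ _)
  · rw [faceNormal, indicator_of_notMem hy, smul_zero, norm_zero]
    exact norm_nonneg _

end Arrangement


/-! ### The divergence theorem for Lipschitz functions -/

section Divergence

variable {m : ℕ} {ι : Type*} [Fintype ι] {D : Set (Vec (m + 1))} {n : ι → Vec (m + 1)}
  {c : ι → ℝ}

/-- The weight of the `i`-th layer. -/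
noncomputable def layerWeight (n : ι → Vec (m + 1)) (c : ι → ℝ) (v : Vec (m + 1)) (t : ℝ) (i : ι)
    (x : Vec (m + 1)) : ℝ := coverWeight (fun j => layer (n j) (c j) v t) i x

/-- The increment of the indicator function of `D` from `x` to `x - t v`. -/
noncomputable def jump (D : Set (Vec (m + 1))) (v : Vec (m + 1)) (t : ℝ) (x : Vec (m + 1)) : ℝ :=
  D.indicator 1 (x - t • v) - D.indicator 1 x

theorem measurable_jump (hDo : IsOpen D) (v : Vec (m + 1)) (t : ℝ) : Measurable (jump D v t) := by
  have hχ : Measurable (D.indicator (1 : Vec (m + 1) → ℝ)) :=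
    measurable_one.indicator hDo.measurableSet
  exact (hχ.comp (by fun_prop)).sub hχ

theorem abs_jump_le (v : Vec (m + 1)) (t : ℝ) (x : Vec (m + 1)) : |jump D v t x| ≤ 1 := by
  unfold jump
  by_cases h1 : x - t • v ∈ D <;> by_cases h2 : x ∈ D <;> simp [h1, h2]

theorem jump_eq_zero {R : ℝ} (hR : D ⊆ Metric.closedBall 0 R) {v : Vec (m + 1)} {t : ℝ}
    (ht : 0 ≤ t) (ht1 : t ≤ 1) {x : Vec (m + 1)} (hx : R + ‖v‖ < ‖x‖) : jump D v t x = 0 := by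
  have htv : ‖t • v‖ ≤ ‖v‖ := by
    rw [norm_smul, Real.norm_of_nonneg ht]
    exact mul_le_of_le_one_left (norm_nonneg _) ht1
  have h1 : x ∉ D := fun h => by
    have := mem_closedBall_zero_iff.1 (hR h)
    linarith [norm_nonneg v]
  have h2 : x - t • v ∉ D := fun h => by
    have := mem_closedBall_zero_iff.1 (hR h)
    linarith [norm_le_norm_sub_add x (t • v)]
  simp [jump, h1, h2]

/-- Measured along `v`, the point `x` has a nonzero offset from every other hyperplane not parallel
to `v`. Once `t` is below all these offsets, `x + t r v` lies in the `i`-th layer alone. -/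
theorem eventually_layerWeight_eq_one {v : Vec (m + 1)} {i : ι} (hv : inner ℝ (n i) v ≠ (0 : ℝ))
    {x : Vec (m + 1)} (hx : inner ℝ (n i) x = c i) (hreg : ∀ j, j ≠ i → inner ℝ (n j) x ≠ c j)
    {r : ℝ} (hr : r ∈ Ioo (0 : ℝ) 1) :
    ∀ᶠ t in 𝓝[>] (0 : ℝ), layerWeight n c v t i (x + (t * r) • v) = 1 := by
  have hev : ∀ᶠ t in 𝓝[>] (0 : ℝ), ∀ j, j ≠ i → x + (t * r) • v ∉ layer (n j) (c j) v t := by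
    rw [eventually_all]
    intro j
    by_cases hj : j = i
    · exact Eventually.of_forall fun t h => absurd hj h
    by_cases hvj : inner ℝ (n j) v = (0 : ℝ)
    · exact Eventually.of_forall fun t _ h => h.1 hvj
    have hne : (inner ℝ (n j) x - c j) / inner ℝ (n j) v ≠ (0 : ℝ) :=
      div_ne_zero (sub_ne_zero.2 (hreg j hj)) hvj
    have hsmall : ∀ᶠ t in 𝓝[>] (0 : ℝ), t < |(inner ℝ (n j) x - c j) / inner ℝ (n j) v| :=
      (tendsto_id.mono_left nhdsWithin_le_nhds).eventually_lt_const (abs_pos.2 hne)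
    filter_upwards [hsmall, self_mem_nhdsWithin] with t ht ht0 _ hmem
    have ht0' : (0 : ℝ) < t := ht0
    have e : (inner ℝ (n j) (x + (t * r) • v) - c j) / inner ℝ (n j) v =
        (inner ℝ (n j) x - c j) / inner ℝ (n j) v + t * r := by
      rw [inner_add_right, inner_smul_right]; field_simp; ring
    have h2 := hmem.2
    rw [e] at h2
    obtain ⟨h3, h4⟩ := h2
    have htr : t * r < t := by nlinarith [hr.2]
    have htr0 : 0 < t * r := mul_pos ht0' hr.1
    rcases abs_cases ((inner ℝ (n j) x - c j) / inner ℝ (n j) v) with ⟨h5, _⟩ | ⟨h5, _⟩ <;>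
      linarith
  filter_upwards [hev, self_mem_nhdsWithin] with t ht ht0
  have ht0' : (0 : ℝ) < t := ht0
  refine coverWeight_eq_one ⟨hv, ?_⟩ ht
  have e : (inner ℝ (n i) (x + (t * r) • v) - c i) / inner ℝ (n i) v = t * r := by
    rw [inner_add_right, inner_smul_right, hx]; field_simp; ring
  rw [e]
  exact ⟨(mul_pos ht0' hr.1).le, by nlinarith [hr.2]⟩

theorem layerWeight_eq_zero {v : Vec (m + 1)} {i : ι} (hv : inner ℝ (n i) v ≠ (0 : ℝ))
    {x : Vec (m + 1)} (hx : inner ℝ (n i) x = c i) {t r : ℝ} (ht : 0 < t)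
    (hr : r ∉ Icc (0 : ℝ) 1) : layerWeight n c v t i (x + (t * r) • v) = 0 := by
  refine coverWeight_of_notMem fun h => hr ?_
  have e : (inner ℝ (n i) (x + (t * r) • v) - c i) / inner ℝ (n i) v = t * r := by
    rw [inner_add_right, inner_smul_right, hx]; field_simp; ring
  have h2 := h.2
  rw [e] at h2
  exact ⟨by by_contra hh; nlinarith [h2.1], by by_contra hh; nlinarith [h2.2]⟩

theorem measurable_layerWeight (v : Vec (m + 1)) (t : ℝ) (i : ι) :
    Measurable (layerWeight n c v t i) :=
  measurable_coverWeight (fun j => measurableSet_layer (n j) (c j) v t) i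

/-- For `0 < r < 1` the points `x + t r v` and `x + t (r - 1) v` lie on opposite sides of the face.
The sign of `⟨n i, v⟩` decides which trace is taken where, and the same sign turns its absolute
value into `⟨n i, v⟩`. -/
theorem IsBoundaryArrangement.tendsto_jump (hA : IsBoundaryArrangement D n c) (hDo : IsOpen D)
    (hint : interior (closure D) = D) {v : Vec (m + 1)} {i : ι} {x : Vec (m + 1)}
    (hv : inner ℝ (n i) v ≠ (0 : ℝ))
    (hx : inner ℝ (n i) x = c i) (hreg : ∀ j, j ≠ i → inner ℝ (n j) x ≠ c j)
    {r : ℝ} (hr : r ∈ Ioo (0 : ℝ) 1) :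
    ∀ᶠ t in 𝓝[>] (0 : ℝ), |inner ℝ (n i) v| * jump D v t (x + (t * r) • v) =
      inner ℝ (faceNormal D x) v := by
  obtain ⟨ρ, hρ, a, b, ha, hb, hN⟩ := hA.exists_traces hDo hint hx hreg
  have h1 := (tendsto_add_smul_nhdsGT x (r • v)).eventually (Metric.ball_mem_nhds _ hρ)
  have h2 := (tendsto_add_smul_nhdsGT x ((r - 1) • v)).eventually (Metric.ball_mem_nhds _ hρ)
  filter_upwards [h1, h2, self_mem_nhdsWithin] with t ht1 ht2 ht0
  have ht0' : (0 : ℝ) < t := ht0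
  have e1 : x + (t * r) • v = x + t • r • v := by rw [smul_smul]
  have e2 : x + (t * r) • v - t • v = x + t • (r - 1) • v := by
    rw [smul_smul, mul_sub, mul_one, sub_smul, add_sub_assoc]
  have i1 : inner ℝ (n i) (x + t • r • v - x) = t * r * inner ℝ (n i) v := by
    rw [add_sub_cancel_left, inner_smul_right, inner_smul_right]; ring
  have i2 : inner ℝ (n i) (x + t • (r - 1) • v - x) = -(t * (1 - r) * inner ℝ (n i) v) := by
    rw [add_sub_cancel_left, inner_smul_right, inner_smul_right]; ring
  have hp1 : 0 < t * r := mul_pos ht0' hr.1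
  have hp2 : 0 < t * (1 - r) := mul_pos ht0' (by linarith [hr.2])
  rw [jump, e2, e1, hN, inner_smul_left, conj_trivial]
  rcases lt_or_gt_of_ne hv with hneg | hpos
  · rw [abs_of_neg hneg, ha _ ht1 (by rw [i1]; nlinarith), hb _ ht2 (by rw [i2]; nlinarith)]
    ring
  · rw [abs_of_pos hpos, hb _ ht1 (by rw [i1]; positivity),
      ha _ ht2 (by rw [i2]; exact neg_lt_zero.2 (by positivity))]
    ring

/-- The contribution of one hyperplane to the derivative of the translations of `D`. -/
theorem IsBoundaryArrangement.tendsto_integral_layer (hA : IsBoundaryArrangement D n c)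
    (hDo : IsOpen D) (hDb : Bornology.IsBounded D) (hint : interior (closure D) = D)
    {i : ι} {Ψ : (ℝ × Vec m) ≃L[ℝ] Vec (m + 1)} (hΨ : MeasurePreserving Ψ)
    (hin : ∀ z, inner ℝ (n i) (Ψ z) = z.1) (hiso : ∀ y, ‖Ψ (0, y)‖ = ‖y‖)
    {f : Vec (m + 1) → ℝ} (hf : Continuous f) {v : Vec (m + 1)}
    (hv : inner ℝ (n i) v ≠ (0 : ℝ)) :
    Tendsto (fun t : ℝ => ∫ x, t⁻¹ * (layerWeight n c v t i x * (f x * jump D v t x))) (𝓝[>] 0)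
      (𝓝 (∫ y : Vec m, f (Ψ (c i, y)) * inner ℝ (faceNormal D (Ψ (c i, y))) v)) := by
  obtain ⟨R, hR0, hR⟩ := hDb.subset_closedBall_lt 0 0
  obtain ⟨M, hM⟩ := (isCompact_closedBall (0 : Vec (m + 1)) (R + ‖v‖)).exists_bound_of_continuousOn
    hf.continuousOn
  have hΨc := Ψ.continuous
  set X : ℝ → ℝ × Vec m → Vec (m + 1) := fun t z => Ψ (c i, z.2) + (t * z.1) • v with hX
  have hXm : ∀ t, Measurable (X t) := fun t => by simp only [hX]; fun_prop
  have hmeas : ∀ t, Measurable fun x => layerWeight n c v t i x * (f x * jump D v t x) := fun t =>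
    (measurable_layerWeight v t i).mul (hf.measurable.mul (measurable_jump hDo v t))
  -- The Jacobian `t |⟨n i, v⟩|` of the layer coordinates cancels the factor `t⁻¹`, so the rescaled
  -- integrand has a pointwise limit.
  set F : ℝ → ℝ × Vec m → ℝ := fun t z =>
    |inner ℝ (n i) v| * (layerWeight n c v t i (X t z) * (f (X t z) * jump D v t (X t z))) with hF
  set g : ℝ × Vec m → ℝ := fun z => (Ioo (0 : ℝ) 1).indicator 1 z.1 *
    (f (Ψ (c i, z.2)) * inner ℝ (faceNormal D (Ψ (c i, z.2))) v) with hg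
  have hgint : ∫ z, g z =
      ∫ y : Vec m, f (Ψ (c i, y)) * inner ℝ (faceNormal D (Ψ (c i, y))) v := by
    rw [hg, Measure.volume_eq_prod,
      integral_prod_mul ((Ioo (0 : ℝ) 1).indicator 1)
        (fun y : Vec m => f (Ψ (c i, y)) * inner ℝ (faceNormal D (Ψ (c i, y))) v),
      integral_indicator_one measurableSet_Ioo]
    simp
  have hFint : ∀ t > 0,
      ∫ x, t⁻¹ * (layerWeight n c v t i x * (f x * jump D v t x)) = ∫ z, F t z := by
    intro t ht
    rw [integral_const_mul, integral_layer hΨ hin (c i) (v := v) (t := t)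
      (mul_ne_zero ht.ne' hv) (hmeas t), ← mul_assoc, abs_mul, abs_of_pos ht, ← mul_assoc,
      inv_mul_cancel₀ ht.ne', one_mul, hF, integral_const_mul]
  rw [← hgint]
  refine Tendsto.congr' (f₁ := fun t => ∫ z, F t z)
    (eventually_of_mem self_mem_nhdsWithin fun t ht => (hFint t ht).symm) ?_
  -- The jump vanishes beyond radius `R + ‖v‖`; the second `‖v‖` bounds the displacement inside the
  -- layer and the last term the offset of the hyperplane from the origin.
  set R' := R + ‖v‖ + ‖v‖ + ‖Ψ (c i, 0)‖ with hR'
  set B : Set (ℝ × Vec m) := Icc (0 : ℝ) 1 ×ˢ Metric.closedBall 0 R' with hB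
  have hBc : IsCompact B := isCompact_Icc.prod (isCompact_closedBall _ _)
  refine tendsto_integral_filter_of_dominated_convergence
    (B.indicator fun _ => |inner ℝ (n i) v| * M) ?_ ?_ ?_ ?_
  · refine Eventually.of_forall fun t => ?_
    exact (((hmeas t).comp (hXm t)).const_mul _).aestronglyMeasurable
  · have h1 : ∀ᶠ t in 𝓝[>] (0 : ℝ), t < 1 :=
      (tendsto_id.mono_left nhdsWithin_le_nhds).eventually_lt_const one_pos
    filter_upwards [h1, self_mem_nhdsWithin] with t ht1 ht0
    have ht0' : (0 : ℝ) < t := ht0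
    refine Eventually.of_forall fun z => ?_
    by_cases hz1 : z.1 ∈ Icc (0 : ℝ) 1
    swap
    · have : layerWeight n c v t i (X t z) = 0 :=
        layerWeight_eq_zero hv (hin (c i, z.2)) ht0' hz1
      rw [indicator_of_notMem (fun h => hz1 h.1)]
      simp [hF, this]
    by_cases hxn : R + ‖v‖ < ‖X t z‖
    · have hj := jump_eq_zero hR ht0'.le ht1.le hxn
      simp only [hF, hj, mul_zero, norm_zero]
      refine indicator_nonneg (fun _ _ => mul_nonneg (abs_nonneg _) ?_) _
      exact (norm_nonneg _).trans (hM 0 (by simpa using add_nonneg hR0.le (norm_nonneg v)))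
    · push Not at hxn
      have hz2 : z ∈ B := by
        refine ⟨hz1, ?_⟩
        rw [mem_closedBall_zero_iff]
        have h3 := norm_le_of_frame hiso (c i) z.2
        have h4 : ‖Ψ (c i, z.2)‖ ≤ ‖X t z‖ + ‖(t * z.1) • v‖ := by
          have : Ψ (c i, z.2) = X t z - (t * z.1) • v := by simp [hX]
          rw [this]; exact norm_sub_le _ _
        have h5 : ‖(t * z.1) • v‖ ≤ ‖v‖ := by
          rw [norm_smul, Real.norm_of_nonneg (mul_nonneg ht0'.le hz1.1)]
          exact mul_le_of_le_one_left (norm_nonneg _) (mul_le_one₀ ht1.le hz1.1 hz1.2)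
        linarith
      rw [indicator_of_mem hz2]
      have h6 := hM (X t z) (by rwa [mem_closedBall_zero_iff])
      simp only [hF]
      have h9 : 0 ≤ layerWeight n c v t i (X t z) := coverWeight_nonneg
      rw [norm_mul, norm_mul, norm_mul, Real.norm_of_nonneg (abs_nonneg _),
        Real.norm_of_nonneg h9]
      refine mul_le_mul_of_nonneg_left ?_ (abs_nonneg _)
      have h7 : layerWeight n c v t i (X t z) ≤ 1 := coverWeight_le_one
      have h8 : ‖jump D v t (X t z)‖ ≤ 1 := abs_jump_le v t _
      calc layerWeight n c v t i (X t z) * (‖f (X t z)‖ * ‖jump D v t (X t z)‖)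
          ≤ 1 * (‖f (X t z)‖ * 1) := by
            have := norm_nonneg (f (X t z))
            gcongr
        _ ≤ M := by linarith
  · exact (integrableOn_const hBc.measure_ne_top).integrable_indicator hBc.measurableSet
  · have h1 : ∀ᵐ z : ℝ × Vec m, ∀ j, j ≠ i → inner ℝ (n j) (Ψ (c i, z.2)) ≠ c j :=
      Measure.quasiMeasurePreserving_snd.ae (hA.ae_regular hin)
    have h2 : ∀ᵐ z : ℝ × Vec m, z.1 ∉ ({0, 1} : Set ℝ) := by
      refine Measure.quasiMeasurePreserving_fst.ae (p := fun r => r ∉ ({0, 1} : Set ℝ)) ?_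
      exact measure_eq_zero_iff_ae_notMem.1 ((Set.toFinite {0, 1}).measure_zero volume)
    filter_upwards [h1, h2] with z hz1 hz2
    by_cases hz : z.1 ∈ Ioo (0 : ℝ) 1
    · have e1 := eventually_layerWeight_eq_one (n := n) (c := c) hv (hin (c i, z.2)) hz1 hz
      have e2 := hA.tendsto_jump hDo hint hv (hin (c i, z.2)) hz1 hz
      have e3 : Tendsto (fun t => f (X t z)) (𝓝[>] 0) (𝓝 (f (Ψ (c i, z.2)))) := by
        have := (hf.tendsto _).comp (tendsto_add_smul_nhdsGT (Ψ (c i, z.2)) (z.1 • v))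
        simpa only [hX, Function.comp_def, smul_smul] using this
      have e4 := e3.mul_const (inner ℝ (faceNormal D (Ψ (c i, z.2))) v)
      have e5 : g z = f (Ψ (c i, z.2)) * inner ℝ (faceNormal D (Ψ (c i, z.2))) v := by
        simp only [hg]; rw [indicator_of_mem hz]; simp
      rw [e5]
      refine e4.congr' ?_
      filter_upwards [e1, e2] with t ht1 ht2
      simp only [hF, hX]
      rw [ht1, ← ht2]; ring
    · have hz' : z.1 ∉ Icc (0 : ℝ) 1 := by
        intro h
        simp only [mem_insert_iff, mem_singleton_iff, not_or] at hz2
        exact hz ⟨lt_of_le_of_ne h.1 (Ne.symm hz2.1), lt_of_le_of_ne h.2 hz2.2⟩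
      have e5 : g z = 0 := by
        simp only [hg]; rw [indicator_of_notMem hz]; simp
      rw [e5]
      refine tendsto_const_nhds.congr' (eventually_of_mem self_mem_nhdsWithin fun t ht => ?_)
      simp only [hF, hX]
      rw [layerWeight_eq_zero hv (hin (c i, z.2)) ht hz']
      simp

/-- Off a null set, points where the indicator function of `D` jumps lie in one of the layers. -/
theorem IsBoundaryArrangement.ae_sum_layerWeight (hA : IsBoundaryArrangement D n c)
    (hDo : IsOpen D) (v : Vec (m + 1)) {t : ℝ} (ht : 0 < t) :
    ∀ᵐ x, ∑ i, layerWeight n c v t i x * jump D v t x = jump D v t x := by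
  have hnull : ∀ᵐ x : Vec (m + 1), ∀ i, inner ℝ (n i) x ≠ c i := by
    rw [eventually_countable_forall]
    intro i
    exact measure_eq_zero_iff_ae_notMem.1 (volume_hyperplane_eq_zero (hA.norm_eq i) (c i))
  filter_upwards [hnull] with x hx
  by_cases hj : x - t • v ∈ D ↔ x ∈ D
  · have : jump D v t x = 0 := by
      by_cases h : x ∈ D
      · simp [jump, h, hj.2 h]
      · simp [jump, h, mt hj.1 h]
    simp [this]
  -- If the indicator jumps, the segment from `x - t v` to `x` meets the frontier at some `x - a t
  -- v` with `0 ≤ a ≤ 1`, so `x` is in the layer of the hyperplane hit there. Were `v` parallel to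
  -- it, `x` would lie on that hyperplane, which is excluded almost everywhere.
  · obtain ⟨z, hz, hzf⟩ := exists_mem_segment_frontier hDo hj
    obtain ⟨i, hi⟩ := mem_iUnion.1 (hA.subset hzf)
    obtain ⟨a, b, ha, hb, hab, rfl⟩ := hz
    have hzx : a • (x - t • v) + b • x = x - (a * t) • v := by
      have : b = 1 - a := by linarith
      rw [this, smul_sub, smul_smul, sub_smul, one_smul]; abel
    rw [hzx, mem_ofPred_eq, inner_sub_right, inner_smul_right] at hi
    have hv : inner ℝ (n i) v ≠ (0 : ℝ) := by
      intro h0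
      rw [h0, mul_zero, sub_zero] at hi
      exact hx i hi
    have hmem : x ∈ layer (n i) (c i) v t := by
      refine ⟨hv, ?_⟩
      have : (inner ℝ (n i) x - c i) / inner ℝ (n i) v = a * t := by
        rw [← hi]; field_simp; ring
      rw [this]
      exact ⟨by positivity, by nlinarith⟩
    rw [← Finset.sum_mul]
    have h1 : ∑ i, layerWeight n c v t i x = 1 :=
      sum_coverWeight (S := fun j => layer (n j) (c j) v t) hmem
    rw [h1, one_mul]

/-- The divergence theorem for a Lipschitz function times a constant vector field. -/
theorem IsBoundaryArrangement.integral_lineDeriv (hA : IsBoundaryArrangement D n c)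
    (hDo : IsOpen D) (hDb : Bornology.IsBounded D) (hint : interior (closure D) = D)
    {Ψ : ι → (ℝ × Vec m) ≃L[ℝ] Vec (m + 1)} (hΨ : ∀ i, MeasurePreserving (Ψ i))
    (hin : ∀ i z, inner ℝ (n i) (Ψ i z) = z.1) (hiso : ∀ i y, ‖Ψ i (0, y)‖ = ‖y‖)
    {f : Vec (m + 1) → ℝ} {C : ℝ≥0} (hf : LipschitzWith C f) (v : Vec (m + 1)) :
    ∫ x in D, lineDeriv ℝ f x v =
      ∑ i, ∫ y : Vec m, f (Ψ i (c i, y)) * inner ℝ (faceNormal D (Ψ i (c i, y))) v := by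
  have hfc := hf.continuous
  have hDm := hDo.measurableSet
  have hχ : Integrable (D.indicator (1 : Vec (m + 1) → ℝ)) := by
    simpa using integrable_mul_indicator (f := fun _ => 1) continuous_const hDm hDb
  -- This limit is compared with `lim2`: translation invariance moves the shift from `f` to the
  -- indicator of `D`, so the same difference quotient is an integral of `t⁻¹ f` times the jump,
  -- which splits over the layers.
  have lim1 := hf.integral_inv_smul_sub_mul_tendsto_integral_lineDeriv_mul (μ := volume) hχ v
  have e0 : ∫ x, lineDeriv ℝ f x v * D.indicator 1 x = ∫ x in D, lineDeriv ℝ f x v := by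
    rw [← integral_indicator hDm]
    refine integral_congr_ae (Eventually.of_forall fun x => ?_)
    by_cases hx : x ∈ D <;> simp [hx]
  rw [e0] at lim1
  have lim2 : Tendsto (fun t : ℝ =>
      ∑ i, ∫ x, t⁻¹ * (layerWeight n c v t i x * (f x * jump D v t x))) (𝓝[>] 0)
      (𝓝 (∑ i, ∫ y : Vec m, f (Ψ i (c i, y)) * inner ℝ (faceNormal D (Ψ i (c i, y))) v)) := by
    refine tendsto_finsetSum _ fun i _ => ?_
    -- A hyperplane parallel to `v` has an empty layer, and its normal contributes nothing to the
    -- flux of `v`.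
    by_cases hv : inner ℝ (n i) v = (0 : ℝ)
    · have h1 : ∫ y : Vec m, f (Ψ i (c i, y)) * inner ℝ (faceNormal D (Ψ i (c i, y))) v = 0 := by
        refine integral_eq_zero_of_ae ?_
        filter_upwards [hA.ae_regular (hin i)] with y hy
        obtain ⟨_, _, a, b, _, _, hN⟩ := hA.exists_traces hDo hint (hin i (c i, y)) hy
        rw [hN, inner_smul_left, hv]; simp
      have h2 : ∀ t x, layerWeight n c v t i x = 0 := fun t x =>
        coverWeight_of_notMem fun h => h.1 hv
      simp [h1, h2]
    · exact hA.tendsto_integral_layer hDo hDb hint (hΨ i) (hin i) (hiso i) hfc hv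
  refine tendsto_nhds_unique lim1 (lim2.congr' ?_)
  filter_upwards [self_mem_nhdsWithin] with t ht
  have ht' : (0 : ℝ) < t := ht
  have hshift : (fun x => D.indicator (1 : Vec (m + 1) → ℝ) (x - t • v)) =
      {x | x - t • v ∈ D}.indicator 1 := by
    funext x
    by_cases hx : x - t • v ∈ D <;> simp [hx]
  have hAm : MeasurableSet {x | x - t • v ∈ D} := hDm.preimage (by fun_prop)
  have hAb : Bornology.IsBounded {x | x - t • v ∈ D} := by
    obtain ⟨R, hR⟩ := hDb.subset_closedBall 0
    refine (Metric.isBounded_closedBall (x := (0 : Vec (m + 1))) (r := R + ‖t • v‖)).subset ?_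
    intro x hx
    have := mem_closedBall_zero_iff.1 (hR hx)
    rw [mem_closedBall_zero_iff]
    linarith [norm_le_norm_sub_add x (t • v)]
  have hI1 : Integrable fun x => f x * D.indicator 1 (x - t • v) := by
    have := integrable_mul_indicator hfc hAm hAb
    rw [← hshift] at this
    exact this
  have hI2 : Integrable fun x => f x * D.indicator 1 x := integrable_mul_indicator hfc hDm hDb
  have hJ : Integrable fun x => f x * jump D v t x := by
    simp only [jump, mul_sub]
    exact hI1.sub hI2
  have hI3 : Integrable fun x => f (x + t • v) * D.indicator 1 x :=
    integrable_mul_indicator (by fun_prop) hDm hDb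
  have e1 : ∫ x, (t⁻¹ • (f (x + t • v) - f x)) * D.indicator 1 x =
      ∫ x, t⁻¹ * (f x * jump D v t x) := by
    have e2 : ∫ x, f (x + t • v) * D.indicator 1 x = ∫ x, f x * D.indicator 1 (x - t • v) := by
      rw [← integral_add_right_eq_self (fun x => f x * D.indicator 1 (x - t • v)) (t • v)]
      simp
    simp only [smul_eq_mul, mul_assoc, integral_const_mul]
    simp only [jump, mul_sub, sub_mul]
    rw [integral_sub hI3 hI2, integral_sub hI1 hI2, e2]
  rw [e1, ← integral_finsetSum]
  · refine integral_congr_ae ?_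
    filter_upwards [hA.ae_sum_layerWeight hDo v ht'] with x hx
    rw [← Finset.mul_sum]
    congr 1
    conv_rhs => rw [← hx, Finset.mul_sum]
    exact Finset.sum_congr rfl fun i _ => by ring
  · intro i _
    refine Integrable.const_mul ?_ _
    refine hJ.bdd_mul (measurable_layerWeight v t i).aestronglyMeasurable (c := 1)
      (Eventually.of_forall fun x => ?_)
    have h9 : 0 ≤ layerWeight n c v t i x := coverWeight_nonneg
    rw [Real.norm_of_nonneg h9]
    exact coverWeight_le_one

/-- Surface integrals over the boundary, computed face by face. -/
theorem IsBoundaryArrangement.integral_surfaceMeasure (hA : IsBoundaryArrangement D n c)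
    (hDo : IsOpen D) (hDb : Bornology.IsBounded D) (hint : interior (closure D) = D)
    {Ψ : ι → (ℝ × Vec m) ≃L[ℝ] Vec (m + 1)}
    (hin : ∀ i z, inner ℝ (n i) (Ψ i z) = z.1) (hiso : ∀ i y, ‖Ψ i (0, y)‖ = ‖y‖)
    {f : Vec (m + 1) → ℝ} (hf : Continuous f) :
    ∫ x, f x • outwardNormal D x ∂(surfaceMeasure D) =
      ∑ i, ∫ y : Vec m, f (Ψ i (c i, y)) • faceNormal D (Ψ i (c i, y)) := by
  set μ : Measure (Vec (m + 1)) := Measure.euclideanHausdorffMeasure m with hμ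
  have hemb : ∀ i, MeasurableEmbedding fun y : Vec m => Ψ i (c i, y) := fun i =>
    (isometry_frame (hiso i) (c i)).isClosedEmbedding.measurableEmbedding
  have hHm : ∀ i, MeasurableSet {x : Vec (m + 1) | inner ℝ (n i) x = c i} := fun i =>
    (measurableSet_singleton (c i)).preimage (f := fun x => inner ℝ (n i) x) (by fun_prop)
  have e1 : ∫ x, f x • outwardNormal D x ∂(surfaceMeasure D) =
      ∫ x in frontier D, f x • faceNormal D x ∂μ := by
    change ∫ x in frontier D, f x • outwardNormal D x ∂μ = _
    refine setIntegral_congr_fun isClosed_frontier.measurableSet fun x hx => ?_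
    simp only [faceNormal, indicator_of_mem hx]
  -- The integrand vanishes off the frontier, so the domain may be enlarged to whole hyperplanes,
  -- which overlap only in null sets.
  have e2 : ∫ x in ⋃ i, {x | inner ℝ (n i) x = c i}, f x • faceNormal D x ∂μ =
      ∫ x in frontier D, f x • faceNormal D x ∂μ := by
    refine setIntegral_eq_of_subset_of_forall_sdiff_eq_zero
      (MeasurableSet.iUnion hHm) hA.subset fun x hx => ?_
    rw [faceNormal, indicator_of_notMem hx.2, smul_zero]
  have hdis : Pairwise (Function.onFun (AEDisjoint μ)
      fun i => {x : Vec (m + 1) | inner ℝ (n i) x = c i}) := by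
    intro i j hij
    have h := volume_frame_hyperplane_eq_zero (hA.norm_eq i) (hA.norm_eq j) (hin i)
      (hA.ne i j hij)
    have h2 : Measure.map (fun y : Vec m => Ψ i (c i, y)) volume
        {x | inner ℝ (n j) x = c j} = 0 := by
      rw [(hemb i).map_apply]; exact h
    rw [map_frame_volume (hin i) (hiso i) (c i), Measure.restrict_apply (hHm j), inter_comm] at h2
    exact h2
  have hI : IntegrableOn (fun x => f x • faceNormal D x)
      (⋃ i, {x | inner ℝ (n i) x = c i}) μ := by
    refine integrableOn_finite_iUnion.2 fun i => ?_
    rw [IntegrableOn, ← map_frame_volume (hin i) (hiso i) (c i), (hemb i).integrable_map_iff]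
    exact hA.integrable_face hDo hDb hint (hin i) (hiso i) hf
  rw [e1, ← e2, integral_iUnion_ae (fun i => (hHm i).nullMeasurableSet) hdis hI, tsum_fintype]
  refine Finset.sum_congr rfl fun i _ => ?_
  rw [← map_frame_volume (hin i) (hiso i) (c i), (hemb i).integral_map]

end Divergence

/-- The divergence theorem on a polyhedral domain, for a Lipschitz function times a constant
vector field. -/
theorem IsPolyhedralDomain.integral_lineDeriv_eq {m : ℕ} {D : Set (Vec (m + 1))}
    (hD : IsPolyhedralDomain D) {f : Vec (m + 1) → ℝ} {C : ℝ≥0} (hf : LipschitzWith C f)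
    (v : Vec (m + 1)) :
    ∫ x in D, lineDeriv ℝ f x v =
      inner ℝ v (∫ x, f x • outwardNormal D x ∂(surfaceMeasure D)) := by
  obtain ⟨ι, _, n, c, hA⟩ := hD.exists_arrangement
  choose Ψ hΨ hin hiso using fun i => exists_hyperplane_frame (n i) (hA.norm_eq i)
  rw [hA.integral_lineDeriv hD.isOpen hD.isBounded hD.interior_closure hΨ hin hiso hf v,
    hA.integral_surfaceMeasure hD.isOpen hD.isBounded hD.interior_closure hin hiso hf.continuous,
    inner_sum]
  refine Finset.sum_congr rfl fun i _ => ?_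
  rw [← integral_inner (hA.integrable_face hD.isOpen hD.isBounded hD.interior_closure (hin i)
    (hiso i) hf.continuous)]
  refine integral_congr_ae (Eventually.of_forall fun y => ?_)
  simp only [inner_smul_right, real_inner_comm]

/-- `∫_D ∇f = ∫_{∂D} f n ds`. -/
theorem IsPolyhedralDomain.integral_gradient {d : ℕ} (hd : 1 ≤ d) {D : Set (Vec d)}
    (hD : IsPolyhedralDomain D) {f : Vec d → ℝ} {C : ℝ≥0} (hf : LipschitzWith C f)
    (hI : IntegrableOn (gradient f) D) :
    ∫ x in D, gradient f x = ∫ x, f x • outwardNormal D x ∂(surfaceMeasure D) := by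
  obtain ⟨m, rfl⟩ : ∃ m, d = m + 1 := ⟨d - 1, by omega⟩
  refine ext_inner_left ℝ fun v => ?_
  rw [← hD.integral_lineDeriv_eq hf v, ← integral_inner hI]
  refine integral_congr_ae (ae_restrict_of_ae ?_)
  filter_upwards [hf.ae_differentiableAt (μ := volume)] with x hx
  rw [hx.lineDeriv_eq_fderiv, real_inner_comm, inner_gradient_left]


/-! ### Mesh-dependent quantities -/

section MeshFacts

variable {d : ℕ} {V : Type*} {D : Set (Vec d)} {φ : V → Vec d → ℝ}

theorem gradient_congr {f g : Vec d → ℝ} {x : Vec d} (h : f =ᶠ[𝓝 x] g) :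
    gradient f x = gradient g x := by
  unfold gradient
  rw [h.fderiv_eq]

theorem norm_gradient_le {f : Vec d → ℝ} {C : ℝ≥0} (hf : LipschitzWith C f) (x : Vec d) :
    ‖gradient f x‖ ≤ C := by
  unfold gradient
  rw [LinearIsometryEquiv.norm_map]
  exact norm_fderiv_le_of_lipschitz ℝ hf

theorem measurable_gradient (f : Vec d → ℝ) : Measurable (gradient f) :=
  (InnerProductSpace.toDual ℝ (Vec d)).symm.continuous.measurable.comp (measurable_fderiv ℝ f)

theorem integrableOn_gradient {f : Vec d → ℝ} {C : ℝ≥0} (hf : LipschitzWith C f)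
    (hb : Bornology.IsBounded D) : IntegrableOn (gradient f) D := by
  refine Measure.integrableOn_of_bounded (M := C) hb.measure_lt_top.ne
    (measurable_gradient f).aestronglyMeasurable (ae_of_all _ fun x => norm_gradient_le hf x)

theorem gradient_eq_of_eqOn_closure {f g : Vec d → ℝ} (hDo : IsOpen D)
    (he : EqOn f g (closure D)) {x : Vec d} (hx : x ∈ D) : gradient f x = gradient g x :=
  gradient_congr (eventually_of_mem (hDo.mem_nhds hx) fun _ hy => he (subset_closure hy))

theorem boundaryMass_smul_boundaryNormal (i : V) :
    boundaryMass D φ i • boundaryNormal D φ i = boundaryVec D φ i := by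
  unfold boundaryNormal boundaryMass
  by_cases h : boundaryVec D φ i = 0
  · simp [h]
  · rw [smul_smul, mul_inv_cancel₀ (norm_ne_zero_iff.2 h), one_smul]

variable [Fintype V]

/-- The divergence theorem above needs a function Lipschitz on the whole space. Replacing `φ i` by
an extension changes neither the gradient in `D` nor the values on `∂D`. -/
theorem IsShapeFamily.exists_extension (hφ : IsShapeFamily D φ) (i : V) :
    ∃ (C : ℝ≥0) (g : Vec d → ℝ), LipschitzWith C g ∧ EqOn (φ i) g (closure D) := by
  obtain ⟨L, hL⟩ := hφ.lipschitz i
  obtain ⟨g, hg, he⟩ := hL.extend_real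
  exact ⟨L, g, hg, he⟩

theorem IsPolyhedralDomain.isCompact_closure (hD : IsPolyhedralDomain D) :
    IsCompact (closure D) := hD.isBounded.isCompact_closure

theorem IsShapeFamily.continuousOn (hφ : IsShapeFamily D φ) (i : V) :
    ContinuousOn (φ i) (closure D) := by
  obtain ⟨L, hL⟩ := hφ.lipschitz i
  exact hL.continuousOn

theorem IsShapeFamily.integrableOn (hφ : IsShapeFamily D φ) (hD : IsPolyhedralDomain D) (i : V) :
    IntegrableOn (φ i) D :=
  ((hφ.continuousOn i).integrableOn_compact hD.isCompact_closure).mono_set subset_closure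

theorem IsShapeFamily.integral_sum (hφ : IsShapeFamily D φ) (hD : IsPolyhedralDomain D)
    (U : V → State d) :
    IntegrableOn (fun x => ∑ i, φ i x • U i) D ∧
      ∫ x in D, ∑ i, φ i x • U i = ∑ i, mass D φ i • U i := by
  have h : ∀ i, IntegrableOn (fun x => φ i x • U i) D := fun i =>
    (hφ.integrableOn hD i).smul_const (U i)
  refine ⟨integrable_finsetSum _ fun i _ => h i, ?_⟩
  rw [integral_finsetSum _ fun i _ => h i]
  exact Finset.sum_congr rfl fun i _ => integral_smul_const _ _

theorem IsShapeFamily.exists_ball (hφ : IsShapeFamily D φ) (hD : IsPolyhedralDomain D) (i : V) :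
    ∃ B : Set (Vec d), IsOpen B ∧ B.Nonempty ∧ B ⊆ {x ∈ D | φ i x ≠ 0} := by
  obtain ⟨x, hx, hx0⟩ := hφ.exists_ne_zero i
  have hc : ContinuousOn (φ i) D := (hφ.continuousOn i).mono subset_closure
  refine ⟨D ∩ φ i ⁻¹' {0}ᶜ, hc.isOpen_inter_preimage hD.isOpen isOpen_compl_singleton,
    ⟨x, hx, hx0⟩, fun y hy => hy⟩

theorem IsShapeFamily.mass_pos (hφ : IsShapeFamily D φ) (hD : IsPolyhedralDomain D) (i : V) :
    0 < mass D φ i := by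
  obtain ⟨B, hBo, hBn, hB⟩ := hφ.exists_ball hD i
  have hnn : 0 ≤ᵐ[volume.restrict D] φ i :=
    ae_restrict_of_forall_mem hD.isOpen.measurableSet fun x hx =>
      hφ.nonneg i x (subset_closure hx)
  rw [mass, setIntegral_pos_iff_support_of_nonneg_ae hnn (hφ.integrableOn hD i)]
  exact (hBo.measure_pos volume hBn).trans_le
    (measure_mono fun x hx => ⟨(hB hx).2, (hB hx).1⟩)

theorem IsShapeFamily.mem_stencil_self (hφ : IsShapeFamily D φ) (hD : IsPolyhedralDomain D)
    (i : V) : i ∈ stencil D φ i := by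
  obtain ⟨B, hBo, hBn, hB⟩ := hφ.exists_ball hD i
  rw [stencil, Finset.mem_filter, inter_self]
  refine ⟨Finset.mem_univ i, ((hBo.measure_pos volume hBn).trans_le ?_).ne'⟩
  exact measure_mono (hB.trans subset_closure)

theorem mem_stencil_comm {i j : V} : j ∈ stencil D φ i ↔ i ∈ stencil D φ j := by
  simp only [stencil, Finset.mem_filter, Finset.mem_univ, true_and]
  rw [inter_comm]

theorem mem_stencilStar {i j : V} : j ∈ stencilStar D φ i ↔ j ≠ i ∧ j ∈ stencil D φ i := by
  simp [stencilStar]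

theorem mem_stencilStar_comm {i j : V} : j ∈ stencilStar D φ i ↔ i ∈ stencilStar D φ j := by
  rw [mem_stencilStar, mem_stencilStar, mem_stencil_comm, ne_comm]

theorem IsShapeFamily.integrableOn_gradient (hφ : IsShapeFamily D φ)
    (hD : IsPolyhedralDomain D) (j : V) : IntegrableOn (gradient (φ j)) D := by
  obtain ⟨C, g, hg, he⟩ := hφ.exists_extension j
  refine (EulerFE.integrableOn_gradient hg hD.isBounded).congr_fun (fun x hx => ?_)
    hD.isOpen.measurableSet
  exact (gradient_eq_of_eqOn_closure hD.isOpen he hx).symm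

theorem IsShapeFamily.integrableOn_smul_gradient (hφ : IsShapeFamily D φ)
    (hD : IsPolyhedralDomain D) (i j : V) :
    IntegrableOn (fun x => φ i x • gradient (φ j) x) D := by
  obtain ⟨M, hM⟩ := hD.isCompact_closure.exists_bound_of_continuousOn (hφ.continuousOn i)
  refine (hφ.integrableOn_gradient hD j).bdd_smul
    M (hφ.integrableOn hD i).aestronglyMeasurable ?_
  exact ae_restrict_of_forall_mem hD.isOpen.measurableSet fun x hx => hM x (subset_closure hx)

/-- The partition of unity is differentiated at points where, by Rademacher's theorem, all shape
functions are differentiable. -/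
theorem IsShapeFamily.sum_gradient (hφ : IsShapeFamily D φ) (hD : IsPolyhedralDomain D) :
    ∀ᵐ x ∂volume.restrict D, ∑ j, gradient (φ j) x = 0 := by
  choose C g hg he using hφ.exists_extension
  have hdiff : ∀ᵐ x : Vec d, ∀ j, DifferentiableAt ℝ (g j) x := by
    rw [eventually_countable_forall]
    exact fun j => (hg j).ae_differentiableAt
  filter_upwards [ae_restrict_of_ae hdiff, ae_restrict_mem hD.isOpen.measurableSet] with x hx hxD
  have h1 : (fun y => ∑ j, g j y) =ᶠ[𝓝 x] fun _ => 1 := by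
    filter_upwards [hD.isOpen.mem_nhds hxD] with y hy
    rw [← hφ.sum_eq_one y (subset_closure hy)]
    exact Finset.sum_congr rfl fun j _ => (he j (subset_closure hy)).symm
  have h2 : fderiv ℝ (fun y => ∑ j, g j y) x = ∑ j, fderiv ℝ (g j) x :=
    fderiv_fun_sum fun j _ => hx j
  rw [h1.fderiv_eq, fderiv_fun_const] at h2
  have h3 : ∑ j, gradient (φ j) x = (InnerProductSpace.toDual ℝ (Vec d)).symm
      (∑ j, fderiv ℝ (g j) x) := by
    rw [map_sum]
    exact Finset.sum_congr rfl fun j _ => gradient_eq_of_eqOn_closure hD.isOpen (he j) hxD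
  rw [h3, ← h2]
  simp

theorem IsShapeFamily.sum_cvec_right (hφ : IsShapeFamily D φ) (hD : IsPolyhedralDomain D)
    (i : V) : ∑ j, cvec D φ i j = 0 := by
  unfold cvec
  rw [← integral_finsetSum _ fun j _ => hφ.integrableOn_smul_gradient hD i j]
  refine integral_eq_zero_of_ae ?_
  filter_upwards [hφ.sum_gradient hD] with x hx
  rw [← Finset.smul_sum, hx, smul_zero, Pi.zero_apply]

/-- Summing over the undifferentiated factor removes it by the partition of unity, and the
divergence theorem applies to what is left. All boundary terms of the balance come from here. -/
theorem IsShapeFamily.sum_cvec_left (hφ : IsShapeFamily D φ) (hd : 1 ≤ d)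
    (hD : IsPolyhedralDomain D) (j : V) : ∑ i, cvec D φ i j = boundaryVec D φ j := by
  obtain ⟨C, g, hg, he⟩ := hφ.exists_extension j
  have h1 : ∑ i, cvec D φ i j = ∫ x in D, gradient g x := by
    unfold cvec
    rw [← integral_finsetSum _ fun i _ => hφ.integrableOn_smul_gradient hD i j]
    refine setIntegral_congr_fun hD.isOpen.measurableSet fun x hx => ?_
    rw [← Finset.sum_smul, hφ.sum_eq_one x (subset_closure hx), one_smul,
      gradient_eq_of_eqOn_closure hD.isOpen he hx]
  rw [h1, hD.integral_gradient hd hg (EulerFE.integrableOn_gradient hg hD.isBounded), boundaryVec]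
  refine setIntegral_congr_fun isClosed_frontier.measurableSet fun x hx => ?_
  rw [he hx.1]

/-- At almost every point of `D` one of the two closed supports is missed: there either `φ i` is
zero, or `φ j` is zero nearby and so is its gradient. Sums over a stencil may thus be extended to
all indices. -/
theorem cvec_eq_zero (hDo : IsOpen D) {i j : V} (h : j ∉ stencil D φ i) : cvec D φ i j = 0 := by
  have h0 : volume (supp D φ j ∩ supp D φ i) = 0 := by
    simpa [stencil] using h
  refine integral_eq_zero_of_ae ?_
  filter_upwards [ae_restrict_of_ae (measure_eq_zero_iff_ae_notMem.1 h0),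
    ae_restrict_mem hDo.measurableSet] with x hx hxD
  by_cases hxi : x ∈ supp D φ i
  · have hxj : x ∉ supp D φ j := fun hxj => hx ⟨hxj, hxi⟩
    have hev : φ j =ᶠ[𝓝 x] fun _ => 0 := by
      filter_upwards [hDo.mem_nhds hxD, isClosed_closure.isOpen_compl.mem_nhds hxj] with y hyD hy
      by_contra hne
      exact hy (subset_closure ⟨hyD, hne⟩)
    have : gradient (φ j) x = 0 := by
      rw [gradient_congr hev]
      simp [gradient]
    simp [this]
  · have : φ i x = 0 := by
      by_contra hne
      exact hxi (subset_closure ⟨hxD, hne⟩)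
    simp [this]

theorem boundaryVec_eq_zero {i : V} (h : i ∉ boundaryNodes D φ) : boundaryVec D φ i = 0 := by
  have h0 : ∀ x ∈ frontier D, φ i x = 0 := by simpa [boundaryNodes] using h
  refine setIntegral_eq_zero_of_forall_eq_zero fun x hx => ?_
  rw [h0 x hx, zero_smul]

end MeshFacts


/-! ### Admissible states -/

section Admissible

variable {d : ℕ}

/-- Clearing denominators leaves polynomial inequalities, suited to cone arguments and to passing to
limits. -/
theorem isAdmissible_iff {u : State d} :
    IsAdmissible u ↔ 0 < rho u ∧ ‖mom u‖ ^ 2 < 2 * rho u * energy u := by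
  refine and_congr_right fun h => ?_
  unfold specificInternalEnergy
  have e : (rho u)⁻¹ * energy u - 1 / 2 * ‖(rho u)⁻¹ • mom u‖ ^ 2 =
      (2 * rho u * energy u - ‖mom u‖ ^ 2) / (2 * rho u ^ 2) := by
    rw [norm_smul, norm_inv, Real.norm_of_nonneg h.le]
    field_simp
  rw [e]
  constructor
  · intro h1
    have := (div_pos_iff_of_pos_right (by positivity)).1 h1
    linarith
  · intro h1
    exact div_pos (by linarith) (by positivity)

theorem IsAdmissible.smul {u : State d} (h : IsAdmissible u) {a : ℝ} (ha : 0 < a) :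
    IsAdmissible (a • u) := by
  rw [isAdmissible_iff] at h ⊢
  have e1 : rho (a • u) = a * rho u := rfl
  have e2 : mom (a • u) = a • mom u := rfl
  have e3 : energy (a • u) = a * energy u := rfl
  rw [e1, e2, e3, norm_smul, Real.norm_of_nonneg ha.le]
  refine ⟨mul_pos ha h.1, ?_⟩
  have := mul_lt_mul_of_pos_left h.2 (pow_pos ha 2)
  nlinarith

theorem IsAdmissible.add {u w : State d} (hu : IsAdmissible u) (hw : IsAdmissible w) :
    IsAdmissible (u + w) := by
  rw [isAdmissible_iff] at hu hw ⊢
  have e1 : rho (u + w) = rho u + rho w := rfl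
  have e2 : mom (u + w) = mom u + mom w := rfl
  have e3 : energy (u + w) = energy u + energy w := rfl
  rw [e1, e2, e3]
  obtain ⟨h1, h2⟩ := hu
  obtain ⟨h3, h4⟩ := hw
  refine ⟨add_pos h1 h3, ?_⟩
  have hn : ‖mom u + mom w‖ ^ 2 ≤ (‖mom u‖ + ‖mom w‖) ^ 2 :=
    pow_le_pow_left₀ (norm_nonneg _) (norm_add_le _ _) 2
  -- With `x` and `y` the lengths of the velocities, the claim reduces to the Cauchy-Schwarz
  -- inequality `(ρ x + σ y)² ≤ (ρ + σ)(ρ x² + σ y²)`, where `ρ` and `σ` are the two densities.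
  obtain ⟨x, hx⟩ : ∃ x, ‖mom u‖ = rho u * x := ⟨‖mom u‖ / rho u, by field_simp⟩
  obtain ⟨y, hy⟩ : ∃ y, ‖mom w‖ = rho w * y := ⟨‖mom w‖ / rho w, by field_simp⟩
  rw [hx] at h2 hn
  rw [hy] at h4 hn
  have h2' : rho u * x ^ 2 < 2 * energy u := by
    by_contra hc; nlinarith [mul_le_mul_of_nonneg_left (not_lt.1 hc) h1.le]
  have h4' : rho w * y ^ 2 < 2 * energy w := by
    by_contra hc; nlinarith [mul_le_mul_of_nonneg_left (not_lt.1 hc) h3.le]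
  have h5 : (rho u * x + rho w * y) ^ 2 ≤ (rho u + rho w) * (rho u * x ^ 2 + rho w * y ^ 2) := by
    nlinarith [mul_nonneg (mul_pos h1 h3).le (sq_nonneg (x - y))]
  have h6 := mul_lt_mul_of_pos_left (add_lt_add h2' h4') (add_pos h1 h3)
  linarith

theorem convex_isAdmissible : Convex ℝ {u : State d | IsAdmissible u} := by
  refine convex_iff_forall_pos.2 fun u hu w hw a b ha hb _ => ?_
  exact (IsAdmissible.smul hu ha).add (IsAdmissible.smul hw hb)

theorem flux_add (p : State d → ℝ) (u : State d) (c c' : Vec d) :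
    flux p u (c + c') = flux p u c + flux p u c' := by
  simp only [flux, inner_add_right, Prod.mk_add_mk, Prod.mk.injEq]
  refine ⟨trivial, ?_, by ring⟩
  rw [add_smul, smul_add]; abel

theorem flux_smul (p : State d → ℝ) (u : State d) (a : ℝ) (c : Vec d) :
    flux p u (a • c) = a • flux p u c := by
  simp only [flux, inner_smul_right, Prod.smul_mk, Prod.mk.injEq, smul_eq_mul]
  refine ⟨trivial, ?_, by ring⟩
  module

/-- The flux is linear in the direction. -/
noncomputable def fluxLinear (p : State d → ℝ) (u : State d) : Vec d →ₗ[ℝ] State d where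
  toFun := flux p u
  map_add' := flux_add p u
  map_smul' := flux_smul p u

theorem flux_zero (p : State d → ℝ) (u : State d) : flux p u 0 = 0 := (fluxLinear p u).map_zero

theorem flux_neg (p : State d → ℝ) (u : State d) (c : Vec d) : flux p u (-c) = -flux p u c :=
  (fluxLinear p u).map_neg c

theorem flux_sum {ι : Type*} (p : State d → ℝ) (u : State d) (s : Finset ι) (c : ι → Vec d) :
    flux p u (∑ i ∈ s, c i) = ∑ i ∈ s, flux p u (c i) := map_sum (fluxLinear p u) c s

/-! ### Wave speeds -/

section Waves

variable {p : State d → ℝ} {u : State d}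

theorem one_lt_gam (hp : 0 < p u) (hu : IsAdmissible u) : 1 < gam p u := by
  have := div_pos hp (mul_pos hu.1 hu.2)
  unfold gam; linarith

theorem soundSpeed_sq (hp : 0 < p u) (hu : IsAdmissible u) :
    soundSpeed p u ^ 2 = gam p u * p u / rho u := by
  have h1 := one_lt_gam hp hu
  have h2 := hu.1
  exact Real.sq_sqrt (by positivity)

theorem soundSpeed_pos (hp : 0 < p u) (hu : IsAdmissible u) : 0 < soundSpeed p u := by
  have h1 := one_lt_gam hp hu
  have h2 := hu.1
  exact Real.sqrt_pos.2 (by positivity)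

theorem soundSpeed_le_headSpeed (hp : 0 < p u) (hu : IsAdmissible u) (q : ℝ) :
    soundSpeed p u ≤ headSpeed p u q := by
  have h1 := one_lt_gam hp hu
  have h2 : 0 ≤ (gam p u + 1) / (2 * gam p u) * max ((q - p u) / p u) 0 :=
    mul_nonneg (by positivity) (le_max_right _ _)
  refine le_mul_of_one_le_right (soundSpeed_pos hp hu).le ?_
  rw [Real.one_le_sqrt]; linarith

theorem continuous_headSpeed : Continuous (headSpeed p u) := by
  unfold headSpeed; fun_prop

/-- States whose mass flux relative to a plane moving with the flow is at least the sound speed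
stay admissible under the addition of the flux. -/
theorem IsAdmissible.smul_add_flux (hp : 0 < p u) (hu : IsAdmissible u) {n : Vec d}
    (hn : ‖n‖ = 1) {s : ℝ} (hs : soundSpeed p u ≤ s + inner ℝ (vel u) n) :
    IsAdmissible (s • u + flux p u n) := by
  have ha := soundSpeed_pos hp hu
  have ha2 := soundSpeed_sq hp hu
  obtain ⟨hρ, he⟩ := hu
  have hm : mom u = rho u • vel u := by
    rw [vel, smul_smul, mul_inv_cancel₀ hρ.ne', one_smul]
  have heE : specificInternalEnergy u * rho u = energy u - 1 / 2 * rho u * ‖vel u‖ ^ 2 := by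
    unfold specificInternalEnergy vel; field_simp
  set e := specificInternalEnergy u
  set ν : ℝ := inner ℝ (vel u) n
  set w := s + ν with hw
  have hw0 : 0 < w := ha.trans_le hs
  have hmn : inner ℝ (mom u) n = rho u * ν := by rw [hm, inner_smul_left]; rfl
  have e1 : rho (s • u + flux p u n) = rho u * w := by
    change s * rho u + inner ℝ (mom u) n = _
    rw [hmn, hw]; ring
  have e2 : mom (s • u + flux p u n) = (rho u * w) • vel u + p u • n := by
    change s • mom u + (inner ℝ (mom u) n • vel u + p u • n) = _
    rw [hmn, hm, smul_smul, ← add_assoc, ← add_smul, hw]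
    congr 2; ring
  have e3 : energy (s • u + flux p u n) = w * energy u + ν * p u := by
    change s * energy u + ν * (energy u + p u) = _
    rw [hw]; ring
  rw [isAdmissible_iff, e1, e2, e3]
  refine ⟨mul_pos hρ hw0, ?_⟩
  have hnorm : ‖(rho u * w) • vel u + p u • n‖ ^ 2 =
      (rho u * w) ^ 2 * ‖vel u‖ ^ 2 + 2 * (rho u * w) * p u * ν + p u ^ 2 := by
    rw [norm_add_sq_real, norm_smul, norm_smul, inner_smul_left, inner_smul_right, hn,
      mul_pow, mul_pow, Real.norm_eq_abs, Real.norm_eq_abs, sq_abs, sq_abs]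
    simp only [conj_trivial]
    ring
  rw [hnorm]
  have hE : energy u = rho u * e + 1 / 2 * rho u * ‖vel u‖ ^ 2 := by linarith
  have hgam : gam p u * (rho u * e) = rho u * e + p u := by
    have : gam p u = 1 + p u / (rho u * e) := rfl
    rw [this]; field_simp
  have hw2 : soundSpeed p u ^ 2 ≤ w ^ 2 := pow_le_pow_left₀ ha.le hs 2
  -- In the admissibility inequality the kinetic and cross terms cancel and exactly this is left. At
  -- `w = a` the right side is `2 p (ρ e + p)`, because `a² = γ p / ρ` and `γ ρ e = ρ e + p`.
  have key : p u ^ 2 < 2 * rho u ^ 2 * e * w ^ 2 := by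
    have h1 : 2 * rho u ^ 2 * e * soundSpeed p u ^ 2 = 2 * p u * (rho u * e + p u) := by
      rw [ha2, ← hgam]; field_simp
    have h2 := mul_le_mul_of_nonneg_left hw2 (by positivity : 0 ≤ 2 * rho u ^ 2 * e)
    have h3 : 0 < p u * (rho u * e) := by positivity
    nlinarith
  rw [hE]
  nlinarith

theorem headSpeed_sq (hp : 0 < p u) (hu : IsAdmissible u) {q : ℝ} (hq : p u ≤ q) :
    headSpeed p u q ^ 2 = (gam p u + 1) / (2 * rho u) *
      (q + (gam p u - 1) / (gam p u + 1) * p u) := by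
  have h1 := one_lt_gam hp hu
  have h2 := hu.1
  have h3 : 0 ≤ (q - p u) / p u := div_nonneg (by linarith) hp.le
  have h4 : 0 ≤ (gam p u + 1) / (2 * gam p u) * ((q - p u) / p u) :=
    mul_nonneg (by positivity) h3
  unfold headSpeed
  rw [max_eq_left h3, mul_pow, soundSpeed_sq hp hu, Real.sq_sqrt (by linarith)]
  field_simp
  ring

theorem waveCurve_sq (hp : 0 < p u) (hu : IsAdmissible u) {q : ℝ} (hq : p u ≤ q) :
    waveCurve p u q ^ 2 = (q - p u) ^ 2 * ((2 / ((gam p u + 1) * rho u)) /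
      (q + (gam p u - 1) / (gam p u + 1) * p u)) := by
  have h1 := one_lt_gam hp hu
  have h2 := hu.1
  have h3 : 0 < gam p u - 1 := by linarith
  have h4 : 0 < q := by linarith
  unfold waveCurve
  rw [if_pos hq, mul_pow, Real.sq_sqrt (by positivity)]

theorem waveCurve_nonneg {q : ℝ} (hq : p u ≤ q) : 0 ≤ waveCurve p u q := by
  unfold waveCurve
  rw [if_pos hq]
  exact mul_nonneg (by linarith) (Real.sqrt_nonneg _)

/-- The velocity change across a wave is less than the speed of its head, by a fixed factor. -/
theorem waveCurve_le (hp : 0 < p u) (hu : IsAdmissible u) {q : ℝ} (hq : 0 ≤ q) :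
    waveCurve p u q ≤ 2 / (gam p u + 1) * headSpeed p u q := by
  have h1 := one_lt_gam hp hu
  have h2 := hu.1
  have h3 : 0 < gam p u - 1 := by linarith
  have hh : 0 < headSpeed p u q := (soundSpeed_pos hp hu).trans_le (soundSpeed_le_headSpeed hp hu q)
  by_cases hpq : p u ≤ q
  · have h4 : 0 < q := by linarith
    rw [← sq_le_sq₀ (waveCurve_nonneg hpq) (by positivity), mul_pow, waveCurve_sq hp hu hpq,
      headSpeed_sq hp hu hpq]
    set b := (gam p u - 1) / (gam p u + 1) * p u with hb
    have hb0 : 0 < b := by positivity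
    have h5 : (q - p u) ^ 2 ≤ (q + b) ^ 2 := pow_le_pow_left₀ (by linarith) (by linarith) 2
    calc (q - p u) ^ 2 * (2 / ((gam p u + 1) * rho u) / (q + b))
        ≤ (q + b) ^ 2 * (2 / ((gam p u + 1) * rho u) / (q + b)) := by gcongr
      _ = (2 / (gam p u + 1)) ^ 2 * ((gam p u + 1) / (2 * rho u) * (q + b)) := by field_simp
  · have h4 : waveCurve p u q ≤ 0 := by
      unfold waveCurve
      rw [if_neg hpq]
      push Not at hpq
      refine mul_nonpos_of_nonneg_of_nonpos ?_ ?_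
      · exact div_nonneg (mul_nonneg zero_le_two (soundSpeed_pos hp hu).le) h3.le
      · have := Real.rpow_le_one (div_nonneg hq hp.le) ((div_le_one hp).2 hpq.le)
          (by positivity : 0 ≤ (gam p u - 1) / (2 * gam p u))
        linarith
    exact h4.trans (by positivity)

theorem exists_le_waveCurve (hp : 0 < p u) (hu : IsAdmissible u) (q₀ B : ℝ) :
    ∃ q, q₀ ≤ q ∧ p u ≤ q ∧ B ≤ waveCurve p u q := by
  have h1 := one_lt_gam hp hu
  have h2 := hu.1
  have h3 : 0 < gam p u - 1 := by linarith
  set k := 2 / ((gam p u + 1) * rho u) with hk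
  have hk0 : 0 < k := by positivity
  -- `q ≥ 2 p` gives `q - p ≥ q / 2`, and `b ≤ q` gives `q + b ≤ 2 q`. The squared wave curve is
  -- then at least `q k / 8`, whence the choice `8 B² / k`.
  set q := max q₀ (max (2 * p u) (8 * B ^ 2 / k)) with hq
  have hq0 : q₀ ≤ q := le_max_left _ _
  have hq1 : 2 * p u ≤ q := (le_max_left _ _).trans (le_max_right _ _)
  have hq2 : 8 * B ^ 2 / k ≤ q := (le_max_right _ _).trans (le_max_right _ _)
  have hpq : p u ≤ q := by linarith
  have hqpos : 0 < q := by linarith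
  refine ⟨q, hq0, hpq, ?_⟩
  refine le_of_abs_le (abs_le_of_sq_le_sq ?_ (waveCurve_nonneg hpq))
  rw [waveCurve_sq hp hu hpq, ← hk]
  set b := (gam p u - 1) / (gam p u + 1) * p u with hb
  have hb0 : 0 < b := by positivity
  have hbq : b ≤ q := by
    have : (gam p u - 1) / (gam p u + 1) ≤ 1 := by
      rw [div_le_one (by positivity)]; linarith
    have := mul_le_mul_of_nonneg_right this hp.le
    linarith
  have h5 : B ^ 2 ≤ q * k / 8 := by
    rw [div_le_iff₀ hk0] at hq2; linarith
  calc B ^ 2 ≤ q * k / 8 := h5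
    _ = (q / 2) ^ 2 * (k / (2 * q)) := by field_simp; norm_num
    _ ≤ (q - p u) ^ 2 * (k / (q + b)) := by
        gcongr
        · linarith
        · linarith

/-- If both extreme speeds vanished, `(v_R - v_L) · n` would be minus the sum of the two head
speeds. At `p*`, however, the velocity changes across the waves compensate it, and each is at most a
factor below `1` times its head speed. -/
theorem maxWaveSpeed_pos {uL uR : State d} (hpL : 0 < p uL) (hpR : 0 < p uR)
    (hL : IsAdmissible uL) (hR : IsAdmissible uR) (n : Vec d) :
    0 < maxWaveSpeed p uL uR n := by
  by_contra hle
  push Not at hle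
  have z1 := abs_nonpos_iff.1 ((le_max_left _ _).trans hle)
  have z2 := abs_nonpos_iff.1 ((le_max_right _ _).trans hle)
  set q := starPressure p uL uR n with hq
  set S := {q : ℝ | 0 ≤ q ∧
    0 ≤ waveCurve p uL q + waveCurve p uR q + inner ℝ (vel uR - vel uL) n} with hS
  have hne : S.Nonempty := by
    obtain ⟨q', h1, h2, h3⟩ := exists_le_waveCurve hpL hL (p uR) (-inner ℝ (vel uR - vel uL) n)
    exact ⟨q', hpL.le.trans h2, by linarith [waveCurve_nonneg h1]⟩
  have hbdd : BddBelow S := ⟨0, fun q hq => hq.1⟩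
  -- `p*` is an infimum, so it is only known to lie in the closure of `S`. The inequality is
  -- therefore weakened to one between continuous head speeds, which passes to the closure.
  set T := {q : ℝ | 0 ≤ 2 / (gam p uL + 1) * headSpeed p uL q +
    2 / (gam p uR + 1) * headSpeed p uR q + inner ℝ (vel uR - vel uL) n} with hT
  have hTc : IsClosed T := by
    have h1 : Continuous (headSpeed p uL) := continuous_headSpeed
    have h2 : Continuous (headSpeed p uR) := continuous_headSpeed
    exact isClosed_le continuous_const (by fun_prop)
  have hST : S ⊆ T := fun r hr => by
    have h1 := waveCurve_le hpL hL hr.1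
    have h2 := waveCurve_le hpR hR hr.1
    have h3 := hr.2
    simp only [hT, mem_ofPred_eq]
    linarith
  have hqT : q ∈ T := closure_minimal hST hTc (csInf_mem_closure hne hbdd)
  have hLq := (soundSpeed_pos hpL hL).trans_le (soundSpeed_le_headSpeed hpL hL q)
  have hRq := (soundSpeed_pos hpR hR).trans_le (soundSpeed_le_headSpeed hpR hR q)
  have hθ : ∀ {w : State d}, 0 < p w → IsAdmissible w → 2 / (gam p w + 1) < 1 := by
    intro w hpw hw
    have := one_lt_gam hpw hw
    rw [div_lt_one (by linarith)]; linarith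
  have h1 := mul_lt_mul_of_pos_right (hθ hpL hL) hLq
  have h2 := mul_lt_mul_of_pos_right (hθ hpR hR) hRq
  have h3 : 0 ≤ 2 / (gam p uL + 1) * headSpeed p uL q +
    2 / (gam p uR + 1) * headSpeed p uR q + inner ℝ (vel uR - vel uL) n := hqT
  rw [inner_sub_left] at h3
  linarith

/-- Averages over the Riemann fan are admissible. -/
theorem isAdmissible_riemann_average {uL uR : State d} (hpL : 0 < p uL) (hpR : 0 < p uR)
    (hL : IsAdmissible uL) (hR : IsAdmissible uR) {n : Vec d} (hn : ‖n‖ = 1) {s : ℝ}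
    (hs : maxWaveSpeed p uL uR n ≤ s) :
    IsAdmissible ((s • uL + flux p uL n) + (s • uR - flux p uR n)) := by
  -- The bounds on the two extreme speeds give `s + v_L · n ≥ a_L` and `s - v_R · n ≥ a_R`, so each
  -- half of the sum is admissible separately.
  have h1 := (neg_abs_le _).trans' (neg_le_neg ((le_max_left _ _).trans hs))
  have h2 := (le_abs_self _).trans ((le_max_right _ _).trans hs)
  have h3 := soundSpeed_le_headSpeed hpL hL (starPressure p uL uR n)
  have h4 := soundSpeed_le_headSpeed hpR hR (starPressure p uL uR n)
  refine IsAdmissible.add (IsAdmissible.smul_add_flux hpL hL hn (by linarith)) ?_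
  rw [sub_eq_add_neg, ← flux_neg]
  refine IsAdmissible.smul_add_flux hpR hR (by rwa [norm_neg]) ?_
  rw [inner_neg_right]
  linarith

end Waves

end Admissible


/-! ### The forward-Euler step -/

/-- A relaxation of a point of a convex set towards other points of the set. -/
theorem _root_.Convex.add_sum_smul_sub_mem {E ι : Type*} [AddCommGroup E] [Module ℝ E] {S : Set E}
    (hS : Convex ℝ S) {x : E} (hx : x ∈ S) {s : Finset ι} {w : ι → ℝ} {y : ι → E}
    (hw : ∀ j ∈ s, 0 ≤ w j) (hw1 : ∑ j ∈ s, w j ≤ 1) (hy : ∀ j ∈ s, y j ∈ S) :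
    x + ∑ j ∈ s, w j • (y j - x) ∈ S := by
  rcases (Finset.sum_nonneg hw).eq_or_lt with h0 | h0
  · have : ∀ j ∈ s, w j = 0 := (Finset.sum_eq_zero_iff_of_nonneg hw).1 h0.symm
    rwa [Finset.sum_eq_zero fun j hj => by rw [this j hj, zero_smul], add_zero]
  · have hz := hS.centerMass_mem hw h0 hy
    have e : x + ∑ j ∈ s, w j • (y j - x) =
        x + (∑ j ∈ s, w j) • (s.centerMass w y - x) := by
      rw [Finset.centerMass, smul_sub, smul_smul, mul_inv_cancel₀ h0.ne', one_smul]
      simp only [smul_sub, Finset.sum_sub_distrib, Finset.sum_smul]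
    rw [e]
    exact hS.add_smul_sub_mem hx hz ⟨h0.le, hw1⟩

/-- The sum of an antisymmetric family over a symmetric relation vanishes. -/
theorem sum_sum_eq_zero_of_antisymm {V E : Type*} [Fintype V] [AddCommGroup E] [Module ℝ E]
    {R : V → Finset V} (hR : ∀ i j, j ∈ R i ↔ i ∈ R j) {A : V → V → E}
    (hA : ∀ i, ∀ j ∈ R i, A i j = -A j i) : ∑ i, ∑ j ∈ R i, A i j = 0 := by
  set S := ∑ i, ∑ j ∈ R i, A i j with hS
  have h1 : S = ∑ j, ∑ i ∈ R j, A i j :=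
    Finset.sum_comm' fun i j => by simp [hR i j]
  have h2 : S = -S := by
    conv_rhs => rw [hS, ← Finset.sum_neg_distrib]
    rw [h1]
    refine Finset.sum_congr rfl fun j _ => ?_
    rw [← Finset.sum_neg_distrib]
    exact Finset.sum_congr rfl fun i hi => hA i j ((hR i j).2 hi)
  have h3 : (2 : ℝ) • S = 0 := by
    rw [two_smul]
    nth_rewrite 1 [h2]
    exact neg_add_cancel S
  exact (smul_eq_zero.1 h3).resolve_left two_ne_zero

section SchemeFacts

variable {d : ℕ} {V : Type*} {D : Set (Vec d)} {φ : V → Vec d → ℝ}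
  {p : State d → ℝ} {lam : State d → State d → Vec d → ℝ} {cfl : ℝ} {α : V → ℝ} {γ : ℝ}
  {U : V → State d}

theorem viscOff_comm (i j : V) : viscOff D φ lam U i j = viscOff D φ lam U j i := max_comm _ _

theorem norm_nvec {i j : V} (h : cvec D φ i j ≠ 0) : ‖nvec D φ i j‖ = 1 := by
  rw [nvec, norm_smul, norm_inv, norm_norm, inv_mul_cancel₀ (norm_ne_zero_iff.2 h)]

theorem maxWaveSpeed_mul_le_viscOff (hlam : IsWaveSpeedBound p lam)
    (hU : ∀ i, IsAdmissible (U i)) {i j : V} (h : cvec D φ i j ≠ 0) :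
    maxWaveSpeed p (U i) (U j) (nvec D φ i j) * ‖cvec D φ i j‖ ≤ viscOff D φ lam U i j :=
  (mul_le_mul_of_nonneg_right (hlam _ _ (hU i) (hU j) _ (norm_nvec h)) (norm_nonneg _)).trans
    (le_max_left _ _)

theorem viscOff_pos (hp : ∀ u, IsAdmissible u → 0 < p u)
    (hlam : IsWaveSpeedBound p lam) (hU : ∀ i, IsAdmissible (U i)) {i j : V} (h : cvec D φ i j ≠ 0) : 0 < viscOff D φ lam U i j :=
  (mul_pos (maxWaveSpeed_pos (hp _ (hU i)) (hp _ (hU j)) (hU i) (hU j) _)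
    (norm_pos_iff.2 h)).trans_le (maxWaveSpeed_mul_le_viscOff hlam hU h)

theorem viscOff_nonneg (hp : ∀ u, IsAdmissible u → 0 < p u)
    (hlam : IsWaveSpeedBound p lam) (hU : ∀ i, IsAdmissible (U i)) (i j : V) : 0 ≤ viscOff D φ lam U i j := by
  by_cases h : cvec D φ i j = 0
  · refine (le_of_eq ?_).trans (le_max_left _ _)
    rw [h, norm_zero, mul_zero]
  · exact (viscOff_pos hp hlam hU h).le

variable [Fintype V]

theorem viscL_of_ne {i j : V} (h : i ≠ j) : viscL D φ lam U i j = viscOff D φ lam U i j := by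
  rw [viscL, if_neg h]

theorem viscL_comm (i j : V) : viscL D φ lam U i j = viscL D φ lam U j i := by
  by_cases h : i = j
  · rw [h]
  · rw [viscL_of_ne h, viscL_of_ne (Ne.symm h), viscOff_comm]

theorem viscH_comm (i j : V) : viscH D φ lam α U i j = viscH D φ lam α U j i := by
  rw [viscH, viscH, viscL_comm, add_comm]

theorem viscL_self (i : V) :
    viscL D φ lam U i i = -∑ j ∈ stencilStar D φ i, viscL D φ lam U i j := by
  rw [viscL, if_pos rfl]
  congr 1
  exact Finset.sum_congr rfl fun j hj => (viscL_of_ne (mem_stencilStar.1 hj).1.symm).symm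

section Physics

variable (hp : ∀ u, IsAdmissible u → 0 < p u) (hlam : IsWaveSpeedBound p lam)
  (hU : ∀ i, IsAdmissible (U i))

theorem barState_self (i : V) : barState D φ p lam U i i = U i := by
  rw [barState, sub_self, smul_zero, sub_zero, ← two_smul ℝ, smul_smul]
  norm_num

include hp hlam hU in
-- With `s = d_ij / ‖c_ij‖`, the auxiliary state is `‖c_ij‖ / (2 d_ij)` times the Riemann average;
-- for `c_ij = 0` it is the midpoint.
theorem isAdmissible_barState (i j : V) : IsAdmissible (barState D φ p lam U i j) := by
  by_cases hij : i = j
  · rw [hij, barState_self]; exact hU j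
  by_cases h : cvec D φ i j = 0
  · rw [barState, h, flux_zero, flux_zero, sub_zero, smul_zero, sub_zero]
    exact ((hU i).add (hU j)).smul (by norm_num)
  · have hc : 0 < ‖cvec D φ i j‖ := norm_pos_iff.2 h
    have hd := viscOff_pos hp hlam hU h
    have hs : maxWaveSpeed p (U i) (U j) (nvec D φ i j) ≤
        viscOff D φ lam U i j / ‖cvec D φ i j‖ :=
      (le_div_iff₀ hc).2 (maxWaveSpeed_mul_le_viscOff hlam hU h)
    have hcn : cvec D φ i j = ‖cvec D φ i j‖ • nvec D φ i j := by
      rw [nvec, smul_smul, mul_inv_cancel₀ hc.ne', one_smul]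
    have key := (isAdmissible_riemann_average (hp _ (hU i)) (hp _ (hU j)) (hU i) (hU j)
      (norm_nvec h) hs).smul (a := ‖cvec D φ i j‖ / (2 * viscOff D φ lam U i j)) (by positivity)
    convert key using 1
    rw [barState, viscL_of_ne hij]
    nth_rewrite 1 [hcn]
    nth_rewrite 2 [hcn]
    rw [flux_smul, flux_smul]
    have e : ‖cvec D φ i j‖ / (2 * viscOff D φ lam U i j) *
        (viscOff D φ lam U i j / ‖cvec D φ i j‖) = 1 / 2 := by field_simp
    have e' : 1 / (2 * viscOff D φ lam U i j) * ‖cvec D φ i j‖ =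
        ‖cvec D φ i j‖ / (2 * viscOff D φ lam U i j) := by field_simp
    simp only [smul_add, smul_sub, smul_smul, e, e']
    abel

include hp hlam hU in
theorem two_viscL_smul_barState {i j : V} (hij : i ≠ j) :
    (2 * viscL D φ lam U i j) • (barState D φ p lam U i j - U i) =
      fluxL D φ p lam U i j + flux p (U i) (cvec D φ i j) := by
  rw [barState, fluxL]
  by_cases h : viscL D φ lam U i j = 0
  · have hc : cvec D φ i j = 0 := by
      by_contra hc
      rw [viscL_of_ne hij] at h
      exact (viscOff_pos hp hlam hU hc).ne' h
    rw [h, hc, flux_zero, flux_zero]; simp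
  · have e : 2 * viscL D φ lam U i j * (1 / (2 * viscL D φ lam U i j)) = 1 := by field_simp
    simp only [smul_sub, smul_add, smul_smul, e, one_smul]
    module

include hp hlam hU in
-- Since `∑_j c_ij = 0`, the terms `f(U_i) c_ij` can be added for free; they complete each flux to a
-- multiple of `Ū_ij - U_i`.
theorem sum_fluxL (hφ : IsShapeFamily D φ) (hD : IsPolyhedralDomain D) (i : V) :
    ∑ j ∈ stencil D φ i, fluxL D φ p lam U i j =
      ∑ j ∈ stencilStar D φ i,
        (2 * viscL D φ lam U i j) • (barState D φ p lam U i j - U i) := by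
  classical
  have h0 : ∑ j ∈ stencil D φ i, flux p (U i) (cvec D φ i j) = 0 := by
    rw [← flux_sum, Finset.sum_subset (Finset.subset_univ _) fun j _ hj =>
      cvec_eq_zero hD.isOpen hj, hφ.sum_cvec_right hD, flux_zero]
  have h1 : ∑ j ∈ stencil D φ i, fluxL D φ p lam U i j =
      ∑ j ∈ stencil D φ i, (fluxL D φ p lam U i j + flux p (U i) (cvec D φ i j)) := by
    rw [Finset.sum_add_distrib, h0, add_zero]
  have h2 : fluxL D φ p lam U i i + flux p (U i) (cvec D φ i i) = 0 := by
    rw [fluxL, sub_self, smul_zero, add_zero, neg_add_cancel]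
  rw [h1, ← Finset.add_sum_erase _ _ (hφ.mem_stencil_self hD i), h2, zero_add]
  have e : (stencil D φ i).erase i = stencilStar D φ i := by ext j; simp [mem_stencilStar]
  rw [e]
  exact Finset.sum_congr rfl fun j hj =>
    (two_viscL_smul_barState hp hlam hU (mem_stencilStar.1 hj).1.symm).symm

include hp hlam hU in
theorem viscL_nonneg {i j : V} (hij : i ≠ j) : 0 ≤ viscL D φ lam U i j := by
  rw [viscL_of_ne hij]
  exact viscOff_nonneg hp hlam hU i j

include hp hlam hU in
theorem viscL_self_nonpos (i : V) : viscL D φ lam U i i ≤ 0 := by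
  rw [viscL_self]
  exact neg_nonpos.2 (Finset.sum_nonneg fun j hj =>
    viscL_nonneg hp hlam hU (mem_stencilStar.1 hj).1.symm)

include hp hlam hU in
theorem timeStep_nonneg (hφ : IsShapeFamily D φ) (hD : IsPolyhedralDomain D) (hcfl : 0 < cfl) :
    0 ≤ timeStep D φ lam cfl U := by
  -- This also covers the empty set of indices, where the infimum is `0` by default.
  refine mul_nonneg hcfl.le (Real.sInf_nonneg ?_)
  rintro _ ⟨i, _, rfl⟩
  have h1 := viscL_self_nonpos (D := D) (φ := φ) hp hlam hU i
  exact div_nonneg_of_nonpos (neg_nonpos.2 (hφ.mass_pos hD i).le) (by linarith)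

include hp hlam hU in
theorem timeStep_mul_le (hφ : IsShapeFamily D φ) (hD : IsPolyhedralDomain D) (hcfl : 0 < cfl)
    (hcfl1 : cfl ≤ 1) (i : V) :
    timeStep D φ lam cfl U / mass D φ i * (2 * ∑ j ∈ stencilStar D φ i, viscL D φ lam U i j) ≤
      1 := by
  have hm := hφ.mass_pos hD i
  have h1 := viscL_self_nonpos (D := D) (φ := φ) hp hlam hU i
  have h2 := viscL_self (D := D) (φ := φ) (lam := lam) (U := U) i
  -- An index left out of the minimum satisfies the bound trivially, because its viscosities sum to
  -- zero.
  by_cases h0 : viscL D φ lam U i i = 0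
  · have : ∑ j ∈ stencilStar D φ i, viscL D φ lam U i j = 0 := by linarith
    rw [this]; simp
  · have hneg : viscL D φ lam U i i < 0 := lt_of_le_of_ne h1 h0
    have hle : sInf ((fun i => - mass D φ i / (2 * viscL D φ lam U i i)) ''
        {i : V | viscL D φ lam U i i ≠ 0}) ≤ - mass D φ i / (2 * viscL D φ lam U i i) :=
      csInf_le (Set.toFinite _).bddBelow ⟨i, h0, rfl⟩
    have hpos : 0 < - mass D φ i / (2 * viscL D φ lam U i i) :=
      div_pos_of_neg_of_neg (by linarith) (by linarith)
    have hτ : timeStep D φ lam cfl U ≤ - mass D φ i / (2 * viscL D φ lam U i i) := by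
      unfold timeStep
      nlinarith
    have e : ∑ j ∈ stencilStar D φ i, viscL D φ lam U i j = -viscL D φ lam U i i := by linarith
    rw [e, div_mul_eq_mul_div, div_le_one hm]
    rw [le_div_iff_of_neg (by linarith)] at hτ
    linarith

include hp hlam hU in
/-- The low-order update is a convex combination of auxiliary states. -/
theorem isAdmissible_lowOrder (hφ : IsShapeFamily D φ) (hD : IsPolyhedralDomain D)
    (hcfl : 0 < cfl) (hcfl1 : cfl ≤ 1) (i : V) :
    IsAdmissible (lowOrder D φ p lam cfl U i) := by
  have hτ := timeStep_nonneg hp hlam hU hφ hD hcfl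
  have hm := hφ.mass_pos hD i
  rw [lowOrder, sum_fluxL hp hlam hU hφ hD i, Finset.smul_sum]
  simp only [smul_smul]
  refine convex_isAdmissible.add_sum_smul_sub_mem (hU i) (fun j hj => ?_) ?_
    (fun j _ => isAdmissible_barState hp hlam hU i j)
  · have := viscL_nonneg (D := D) (φ := φ) hp hlam hU (mem_stencilStar.1 hj).1.symm
    positivity
  · rw [← Finset.mul_sum, ← Finset.mul_sum]
    exact timeStep_mul_le hp hlam hU hφ hD hcfl hcfl1 i

/-! ### Limiting -/

include hp hlam hU in
theorem psiFlatMin_pos (hφ : IsShapeFamily D φ) (hD : IsPolyhedralDomain D) (i : V) :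
    0 < psiFlatMin D φ p lam U i := by
  have hmem := (Set.Nonempty.image (fun j => psiFlat (barState D φ p lam U i j))
    ⟨i, Finset.mem_coe.2 (hφ.mem_stencil_self hD i)⟩).csInf_mem
    ((stencil D φ i).finite_toSet.image _)
  obtain ⟨j, _, hj⟩ := hmem
  rw [psiFlatMin, ← hj]
  exact (isAdmissible_barState hp hlam hU i j).1

theorem internalEnergy_eq {u : State d} (h : 0 < rho u) :
    2 * rho u * internalEnergy u = 2 * rho u * energy u - ‖mom u‖ ^ 2 := by
  unfold internalEnergy; field_simp

theorem internalEnergy_pos {u : State d} (h : IsAdmissible u) : 0 < internalEnergy u := by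
  rw [isAdmissible_iff] at h
  have h1 := internalEnergy_eq h.1
  have h2 := h.2
  by_contra hc
  nlinarith [h.1]

include hU in
theorem phiMin_pos (hφ : IsShapeFamily D φ) (hD : IsPolyhedralDomain D) (i : V) :
    0 < phiMin D φ γ U i := by
  have hmem := (Set.Nonempty.image (fun j => phiEntropy γ (U j))
    ⟨i, Finset.mem_coe.2 (hφ.mem_stencil_self hD i)⟩).csInf_mem ((stencil D φ i).finite_toSet.image _)
  obtain ⟨j, _, hj⟩ := hmem
  rw [phiMin, ← hj]
  exact mul_pos (internalEnergy_pos (hU j)) (Real.rpow_pos_of_pos (hU j).1 _)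

theorem oneSidedLimiter_nonneg (i : V) (W P : State d) :
    0 ≤ oneSidedLimiter D φ p lam γ U i W P := Real.sSup_nonneg fun _ h => h.1.1

include hp hlam hU in
-- `W` itself need not satisfy the bounds; it only has to be admissible. It then suffices to treat
-- the supremum, since smaller `l` give points on the segment from `W`.
theorem isAdmissible_add_smul (hφ : IsShapeFamily D φ) (hD : IsPolyhedralDomain D) (hγ : 1 < γ)
    (i : V) {W P : State d} (hW : IsAdmissible W) {l : ℝ} (hl : 0 ≤ l)
    (hl1 : l ≤ oneSidedLimiter D φ p lam γ U i W P) : IsAdmissible (W + l • P) := by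
  have hρ0 := psiFlatMin_pos (D := D) (φ := φ) hp hlam hU hφ hD i
  have hΦ0 := phiMin_pos (D := D) (φ := φ) (γ := γ) hU hφ hD i
  unfold oneSidedLimiter at hl1
  set ρ₀ := psiFlatMin D φ p lam U i
  set Φ₀ := phiMin D φ γ U i
  set S := {l : ℝ | l ∈ Icc (0 : ℝ) 1 ∧ ρ₀ ≤ psiFlat (W + l • P) ∧
    psiSharpMin D φ p lam U i ≤ psiSharp (W + l • P) ∧ Φ₀ ≤ phiEntropy γ (W + l • P)} with hS
  rcases S.eq_empty_or_nonempty with he | hne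
  · rw [he, Real.sSup_empty] at hl1
    rw [le_antisymm hl1 hl, zero_smul, add_zero]
    exact hW
  have hbdd : BddAbove S := ⟨1, fun _ h => h.1.2⟩
  -- The supremum is not shown to be attained. The bounds imply these closed conditions, which no
  -- longer contain a real power of the variable density and whose positive left sides still force
  -- admissibility in the limit.
  set T := {l : ℝ | ρ₀ ≤ rho W + l * rho P ∧ 2 * ρ₀ * (Φ₀ * ρ₀ ^ γ) ≤
    2 * (rho W + l * rho P) * (energy W + l * energy P) - ‖mom W + l • mom P‖ ^ 2} with hT
  have hTc : IsClosed T := by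
    have h1 : IsClosed {l : ℝ | ρ₀ ≤ rho W + l * rho P} :=
      isClosed_le (by fun_prop) (by fun_prop)
    have h2 : IsClosed {l : ℝ | 2 * ρ₀ * (Φ₀ * ρ₀ ^ γ) ≤ 2 * (rho W + l * rho P) *
        (energy W + l * energy P) - ‖mom W + l • mom P‖ ^ 2} :=
      isClosed_le (by fun_prop) (by fun_prop)
    exact h1.inter h2
  have hST : S ⊆ T := by
    rintro l ⟨_, h1, _, h2⟩
    refine ⟨h1, ?_⟩
    have h1' : ρ₀ ≤ rho (W + l • P) := h1
    have hρ : 0 < rho (W + l • P) := hρ0.trans_le h1'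
    have h3 : Φ₀ * rho (W + l • P) ^ γ ≤ internalEnergy (W + l • P) := by
      rw [phiEntropy, Real.rpow_neg hρ.le, ← div_eq_mul_inv,
        le_div_iff₀ (Real.rpow_pos_of_pos hρ _)] at h2
      exact h2
    have h4 : ρ₀ ^ γ ≤ rho (W + l • P) ^ γ :=
      Real.rpow_le_rpow hρ0.le h1' (by linarith)
    have h5 : Φ₀ * ρ₀ ^ γ ≤ internalEnergy (W + l • P) :=
      (mul_le_mul_of_nonneg_left h4 hΦ0.le).trans h3
    have h6 : 0 ≤ Φ₀ * ρ₀ ^ γ := mul_nonneg hΦ0.le (Real.rpow_nonneg hρ0.le _)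
    have h7 := internalEnergy_eq hρ
    calc 2 * ρ₀ * (Φ₀ * ρ₀ ^ γ) ≤ 2 * rho (W + l • P) * internalEnergy (W + l • P) := by gcongr
      _ = _ := h7
  have hTadm : ∀ l ∈ T, IsAdmissible (W + l • P) := by
    rintro l ⟨h1, h2⟩
    rw [isAdmissible_iff]
    have h3 : 0 < 2 * ρ₀ * (Φ₀ * ρ₀ ^ γ) :=
      mul_pos (by linarith) (mul_pos hΦ0 (Real.rpow_pos_of_pos hρ0 _))
    exact ⟨hρ0.trans_le h1, sub_pos.1 (h3.trans_le h2)⟩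
  have hsup := hTadm _ (closure_minimal hST hTc (csSup_mem_closure hne hbdd))
  rcases hl.eq_or_lt with h0 | h0
  · rw [← h0, zero_smul, add_zero]; exact hW
  · have hpos : 0 < sSup S := h0.trans_le hl1
    have := convex_isAdmissible.add_smul_mem hW hsup (t := l / sSup S)
      ⟨by positivity, (div_le_one hpos).2 hl1⟩
    rwa [smul_smul, div_mul_cancel₀ _ hpos.ne'] at this

theorem limiter_comm (W : V → State d) (P : V → V → State d) (i j : V) :
    limiter D φ p lam γ U W P i j = limiter D φ p lam γ U W P j i := min_comm _ _

theorem card_stencil (hφ : IsShapeFamily D φ) (hD : IsPolyhedralDomain D) (i : V) :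
    ((stencil D φ i).card : ℝ) - 1 = (stencilStar D φ i).card := by
  classical
  have e : (stencil D φ i).erase i = stencilStar D φ i := by ext j; simp [mem_stencilStar]
  rw [← Finset.card_erase_add_one (hφ.mem_stencil_self hD i), e]
  push_cast; ring

theorem weight_eq (hφ : IsShapeFamily D φ) (hD : IsPolyhedralDomain D) (i : V) :
    weight D φ i = ((stencilStar D φ i).card : ℝ)⁻¹ := by
  rw [weight, card_stencil hφ hD]

include hp hlam hU in
-- The new state relaxes `W_i` towards the admissible states `W_i + ℓ_ij P_ij` with weights `λ_i` of
-- total at most `1`. For a node without neighbours the sum is empty.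
theorem isAdmissible_limiterPass (hφ : IsShapeFamily D φ) (hD : IsPolyhedralDomain D)
    (hγ : 1 < γ) {WP : (V → State d) × (V → V → State d)} (hW : ∀ i, IsAdmissible (WP.1 i))
    (i : V) : IsAdmissible ((limiterPass D φ p lam γ U WP).1 i) := by
  have e : (limiterPass D φ p lam γ U WP).1 i = WP.1 i + ∑ j ∈ stencilStar D φ i,
      weight D φ i •
        ((WP.1 i + limiter D φ p lam γ U WP.1 WP.2 i j • WP.2 i j) - WP.1 i) := by
    simp only [limiterPass, add_sub_cancel_left, smul_smul]
  rw [e]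
  refine convex_isAdmissible.add_sum_smul_sub_mem (hW i) (fun j _ => ?_) ?_ fun j _ => ?_
  · rw [weight_eq hφ hD]; positivity
  · rw [Finset.sum_const, weight_eq hφ hD, nsmul_eq_mul]
    exact mul_inv_le_one
  · exact isAdmissible_add_smul hp hlam hU hφ hD hγ i (hW i)
      (le_min (oneSidedLimiter_nonneg _ _ _) (oneSidedLimiter_nonneg _ _ _)) (min_le_left _ _)

include hp hlam hU in
theorem isAdmissible_eulerStep (hφ : IsShapeFamily D φ) (hD : IsPolyhedralDomain D)
    (hγ : 1 < γ) (hcfl : 0 < cfl) (hcfl1 : cfl ≤ 1) (K : ℕ) (i : V) :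
    IsAdmissible (eulerStep D φ p lam cfl α γ U K i) := by
  unfold eulerStep
  induction K generalizing i with
  | zero => exact isAdmissible_lowOrder hp hlam hU hφ hD hcfl hcfl1 i
  | succ K ih =>
    rw [Function.iterate_succ_apply']
    exact isAdmissible_limiterPass hp hlam hU hφ hD hγ ih i

end Physics

/-! ### Conservation -/

/-- The increments exchanged between neighbours cancel. -/
def IsExchange (D : Set (Vec d)) (φ : V → Vec d → ℝ) (P : V → V → State d) : Prop :=
  ∀ i, ∀ j ∈ stencilStar D φ i,
    (mass D φ i * weight D φ i) • P i j = -((mass D φ j * weight D φ j) • P j i)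

theorem isExchange_increment (hφ : IsShapeFamily D φ) (hD : IsPolyhedralDomain D) :
    IsExchange D φ (increment D φ p lam cfl α U) := by
  have key : ∀ i j, j ∈ stencilStar D φ i → (mass D φ i * weight D φ i) •
      increment D φ p lam cfl α U i j = timeStep D φ lam cfl U •
      (bcoef D φ i j • fluxH D φ p lam α U j - bcoef D φ j i • fluxH D φ p lam α U i
      + (viscH D φ lam α U i j - viscL D φ lam U i j) • (U j - U i)) := by
    intro i j hj
    -- The neighbour `j` makes the cardinality nonzero, so that multiplying by `m_i λ_i` undoes the
    -- division in `P_ij`.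
    have h1 : weight D φ i ≠ 0 := by
      rw [weight_eq hφ hD]
      exact inv_ne_zero (Nat.cast_ne_zero.2 (Finset.card_ne_zero_of_mem hj))
    have h2 := (hφ.mass_pos hD i).ne'
    rw [increment, smul_smul, mul_div_cancel₀ _ (mul_ne_zero h2 h1)]
  intro i j hj
  rw [key i j hj, key j i (mem_stencilStar_comm.1 hj), viscH_comm j i, viscL_comm j i]
  module

/-- The factor `1 - ℓ_ij` is symmetric, so antisymmetry survives every pass. -/
theorem IsExchange.limiterPass {WP : (V → State d) × (V → V → State d)}
    (h : IsExchange D φ WP.2) : IsExchange D φ (limiterPass D φ p lam γ U WP).2 := by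
  intro i j hj
  simp only [EulerFE.limiterPass]
  rw [smul_comm, h i j hj, limiter_comm _ _ j i, smul_neg, smul_comm]

theorem IsExchange.sum_limiterPass {WP : (V → State d) × (V → V → State d)}
    (h : IsExchange D φ WP.2) :
    ∑ i, mass D φ i • (EulerFE.limiterPass D φ p lam γ U WP).1 i = ∑ i, mass D φ i • WP.1 i := by
  simp only [EulerFE.limiterPass, smul_add, Finset.sum_add_distrib, Finset.smul_sum, smul_smul]
  rw [add_eq_left]
  refine sum_sum_eq_zero_of_antisymm (fun i j => mem_stencilStar_comm) fun i j hj => ?_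
  have := congrArg (fun u => limiter D φ p lam γ U WP.1 WP.2 i j • u) (h i j hj)
  simp only [smul_neg, smul_smul] at this
  rw [limiter_comm _ _ j i]
  convert this using 2
  · ring
  · congr 1; ring

theorem sum_eulerStep (hφ : IsShapeFamily D φ) (hD : IsPolyhedralDomain D) (K : ℕ) :
    ∑ i, mass D φ i • eulerStep D φ p lam cfl α γ U K i =
      ∑ i, mass D φ i • lowOrder D φ p lam cfl U i := by
  have key : IsExchange D φ ((limiterPass D φ p lam γ U)^[K]
      (lowOrder D φ p lam cfl U, increment D φ p lam cfl α U)).2 ∧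
      ∑ i, mass D φ i • ((limiterPass D φ p lam γ U)^[K]
        (lowOrder D φ p lam cfl U, increment D φ p lam cfl α U)).1 i =
      ∑ i, mass D φ i • lowOrder D φ p lam cfl U i := by
    induction K with
    | zero => exact ⟨isExchange_increment hφ hD, rfl⟩
    | succ K ih =>
      rw [Function.iterate_succ_apply']
      exact ⟨ih.1.limiterPass, ih.1.sum_limiterPass.trans ih.2⟩
  exact key.2

/-- The viscous part is antisymmetric. In the flux part, exchanging the sums gathers `∑_i c_ij` as
the argument of `f(U_j)`, which is zero unless `j` is a boundary node. -/
theorem sum_sum_fluxL (hφ : IsShapeFamily D φ) (hd : 1 ≤ d) (hD : IsPolyhedralDomain D) :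
    ∑ i, ∑ j ∈ stencil D φ i, fluxL D φ p lam U i j =
      -∑ i ∈ boundaryNodes D φ, boundaryMass D φ i • flux p (U i) (boundaryNormal D φ i) := by
  have h1 : ∑ i, ∑ j ∈ stencil D φ i, viscL D φ lam U i j • (U j - U i) = 0 := by
    refine sum_sum_eq_zero_of_antisymm (fun i j => mem_stencil_comm) fun i j _ => ?_
    rw [viscL_comm j i]; module
  have h2 : ∀ i, ∑ j ∈ stencil D φ i, flux p (U j) (cvec D φ i j) =
      ∑ j, flux p (U j) (cvec D φ i j) := fun i =>
    Finset.sum_subset (Finset.subset_univ _) fun j _ hj => by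
      rw [cvec_eq_zero hD.isOpen hj, flux_zero]
  have h3 : ∑ j, flux p (U j) (boundaryVec D φ j) =
      ∑ i ∈ boundaryNodes D φ, boundaryMass D φ i • flux p (U i) (boundaryNormal D φ i) := by
    rw [← Finset.sum_subset (Finset.subset_univ (boundaryNodes D φ)) fun j _ hj => by
      rw [boundaryVec_eq_zero hj, flux_zero]]
    refine Finset.sum_congr rfl fun j _ => ?_
    rw [← flux_smul, boundaryMass_smul_boundaryNormal]
  simp only [fluxL, Finset.sum_add_distrib, Finset.sum_neg_distrib]
  rw [h1, add_zero]
  simp only [h2]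
  rw [Finset.sum_comm, ← h3]
  simp only [← flux_sum, hφ.sum_cvec_left hd hD]

theorem sum_lowOrder (hφ : IsShapeFamily D φ) (hd : 1 ≤ d) (hD : IsPolyhedralDomain D) :
    ∑ i, mass D φ i • lowOrder D φ p lam cfl U i + timeStep D φ lam cfl U •
      ∑ i ∈ boundaryNodes D φ, boundaryMass D φ i • flux p (U i) (boundaryNormal D φ i) =
      ∑ i, mass D φ i • U i := by
  have h1 : ∀ i, mass D φ i • lowOrder D φ p lam cfl U i = mass D φ i • U i +
      timeStep D φ lam cfl U • ∑ j ∈ stencil D φ i, fluxL D φ p lam U i j := by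
    intro i
    rw [lowOrder, smul_add, smul_smul, mul_div_cancel₀ _ (hφ.mass_pos hD i).ne']
  simp only [h1, Finset.sum_add_distrib, ← Finset.smul_sum]
  rw [sum_sum_fluxL hφ hd hD, smul_neg, neg_add_cancel_right]

end SchemeFacts

end EulerFE

theorem lemma3p1 {d : ℕ} (hd : 1 ≤ d) {V : Type*} [Fintype V]
    (D : Set (EulerFE.Vec d)) (hD : EulerFE.IsPolyhedralDomain D)
    (φ : V → EulerFE.Vec d → ℝ) (hφ : EulerFE.IsShapeFamily D φ) :
    -- (i) mass of a finite element field
    (∀ U : V → EulerFE.State d,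
      IntegrableOn (fun x => ∑ i, φ i x • U i) D ∧
      ∫ x in D, ∑ i, φ i x • U i = ∑ i, EulerFE.mass D φ i • U i) ∧
    -- (ii) admissibility and balance after one forward-Euler step and limiting
    (∀ p : EulerFE.State d → ℝ, (∀ u, EulerFE.IsAdmissible u → 0 < p u) →
      ∀ lam : EulerFE.State d → EulerFE.State d → EulerFE.Vec d → ℝ,
        EulerFE.IsWaveSpeedBound p lam →
      ∀ α : V → ℝ, (∀ i, α i ∈ Set.Icc (0 : ℝ) 1) →
      ∀ γ : ℝ, 1 < γ →
      ∀ cfl : ℝ, 0 < cfl →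
      ∀ K : ℕ, 1 ≤ K →
      ∀ U : V → EulerFE.State d, (∀ i, EulerFE.IsAdmissible (U i)) →
        (cfl ≤ 1 →
          ∀ i, EulerFE.IsAdmissible (EulerFE.eulerStep D φ p lam cfl α γ U K i)) ∧
        ∑ i, EulerFE.mass D φ i • EulerFE.eulerStep D φ p lam cfl α γ U K i
          + EulerFE.timeStep D φ lam cfl U •
              ∑ i ∈ EulerFE.boundaryNodes D φ,
                EulerFE.boundaryMass D φ i •
                  EulerFE.flux p (U i) (EulerFE.boundaryNormal D φ i)
          = ∑ i, EulerFE.mass D φ i • U i) := by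
  refine ⟨hφ.integral_sum hD, fun p hp lam hlam α hα γ hγ cfl hcfl K hK U hU => ⟨?_, ?_⟩⟩
  · intro hcfl1 i
    exact EulerFE.isAdmissible_eulerStep hp hlam hU hφ hD hγ hcfl hcfl1 K i
  · rw [EulerFE.sum_eulerStep hφ hD K]
    exact EulerFE.sum_lowOrder hφ hd hD
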